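/- Let $a\in\mathbb R$, $a\neq 0$, let $U\subset\mathbb R^2$ be a nonempty open set, and let $h,H:U\to(0,\infty)$ be smooth functions of $(x,y)$ such that $$\Delta\ln H=(\ln H)_{xx}+(\ln H)_{yy}=2a^2h^2-4a^2H^2\quad\text{on }U.$$ Let $g_\Sigma=h^2(dx^2+dy^2)$, let $\omega_\Sigma=h^2\,dx\wedge dy$, and put $l_2=-\frac1{2a}(\ln H)_y$, $n_2=\frac1{2a}(\ln H)_x$. On $$M=U\times\Big\{(z,t)\in\mathbb R^2:\ 0<|z|<\tfrac{\pi}{2|a|}\Big\}$$ define $$\theta_3=\sin(2az)\,dt-\big(\cos(2at)\cos(2az)H+\sin(2az)\,l_2\big)dx-\big(-\sin(2at)\cos(2az)H+\sin(2az)\,n_2\big)dy,$$ $$\theta_4=dz-\sin(2at)H\,dx-\cos(2at)H\,dy,\qquad g=(\cos az)^2g_\Sigma+\theta_3\otimes\theta_3+\theta_4\otimes\theta_4 .$$ Then $g$ is a Riemannian metric on $M$, and there are almost complex structures $\bar J$ and $J$ on $M$ such that: 1. $(M,g,\bar J)$ is a Kähler surface with Kähler form $\bar\Omega=g(\bar J\cdot,\cdot)=(\cos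 az)^2\omega_\Sigma+\theta_4\wedge\theta_3$. It is a QCH Kähler surface with respect to the $\bar J$-invariant distribution $\mathcal D=\operatorname{span}\{\partial_z,\partial_t\}$: for a unit tangent vector $X$ at $p$, the holomorphic sectional curvature $g(R(X,\bar JX)\bar JX,X)$ depends only on $p$ and on $|X_{\mathcal D}|$, where $X_{\mathcal D}$ is the orthogonal projection of $X$ onto $\mathcal D$. 2. $(M,g,J)$ is a Hermitian surface with Kähler form $\Omega=g(J\cdot,\cdot)=(\cos az)^2\omega_\Sigma+\theta_3\wedge\theta_4$, and $J$ is opposite to $\bar J$ (for the orientation in which $\bar\Omega$ is self-dual, $\Omega$ is anti-self-dual). 3. The Ricci tensor $\rho$ of $(M,g)$ is $J$-invariant: $\rho(JX,JY)=\rho(X,Y)$. 4. $(M,g,J)$ is not locally conformally Kähler. 5. The Lee form of $(M,g,J)$, i.e. the unique one-form $\theta$ with $d\Omega=2\theta\wedge\Omega$, is $\theta=-\alpha\theta_4$ with $\alpha=2a\tan(az)$. -/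

import Mathlib

open scoped ContDiff

namespace KaehlerSurface

noncomputable section

/-- Coordinate space `ℝ⁴` with coordinates `(x, y, z, t) = (p 0, p 1, p 2, p 3)`. -/
abbrev E4 := Fin 4 → ℝ

/-- The coordinate vector field `∂ᵢ`. -/
def e (i : Fin 4) : E4 := Pi.single i 1

/-- The coordinate one-form `dxⁱ`. -/
def dx (i : Fin 4) : E4 →L[ℝ] ℝ := ContinuousLinearMap.proj i

/-! ### Tensor fields on open subsets of `ℝ⁴`

A symmetric two-tensor field is a map `E4 → E4 →L[ℝ] E4 →L[ℝ] ℝ`, a field of endomorphisms is a map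
`E4 → E4 →L[ℝ] E4`, and a differential `n`-form is a map `E4 → E4 [⋀^Fin n]→L[ℝ] ℝ`. -/

/-- The tensor product `α ⊗ β` of two covectors, `(α ⊗ β)(X, Y) = α(X) β(Y)`. -/
def tensor (α β : E4 →L[ℝ] ℝ) : E4 →L[ℝ] E4 →L[ℝ] ℝ := α.smulRight β

/-- The wedge product of a covector `α` with an `n`-covector `w`:
`(α ∧ w)(v₀, …, vₙ) = ∑ i, (-1)ⁱ α(vᵢ) w(v₀, …, v̂ᵢ, …, vₙ)`. -/
def wedge {n : ℕ} (α : E4 →L[ℝ] ℝ) (w : E4 [⋀^Fin n]→L[ℝ] ℝ) : E4 [⋀^Fin (n + 1)]→L[ℝ] ℝ :=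
  ContinuousAlternatingMap.alternatizeUncurryFin (α.smulRight w)

/-- The wedge product of two covectors, `(α ∧ β)(X, Y) = α(X) β(Y) - α(Y) β(X)`. -/
def wedge₁ (α β : E4 →L[ℝ] ℝ) : E4 [⋀^Fin 2]→L[ℝ] ℝ :=
  wedge α (ContinuousAlternatingMap.ofSubsingleton ℝ E4 ℝ (0 : Fin 1) β)

/-- `g` is a smooth Riemannian metric on `M`. -/
structure IsRiemannianMetricOn (M : Set E4) (g : E4 → E4 →L[ℝ] E4 →L[ℝ] ℝ) : Prop where
  smooth : ContDiffOn ℝ ∞ g M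
  symm : ∀ p ∈ M, ∀ X Y : E4, g p X Y = g p Y X
  pos : ∀ p ∈ M, ∀ X : E4, X ≠ 0 → 0 < g p X X

/-! ### Levi-Civita connection and curvature in coordinates -/

/-- The matrix `gᵢⱼ` of the metric. -/
def gram (g : E4 → E4 →L[ℝ] E4 →L[ℝ] ℝ) (p : E4) : Matrix (Fin 4) (Fin 4) ℝ :=
  Matrix.of fun i j => g p (e i) (e j)

/-- The partial derivative `∂ᵢ f`. -/
def pd (i : Fin 4) (f : E4 → ℝ) (p : E4) : ℝ := fderiv ℝ f p (e i)

/-- The Christoffel symbols `Γᵏᵢⱼ = ½ gᵏˡ (∂ᵢ gⱼₗ + ∂ⱼ gᵢₗ - ∂ₗ gᵢⱼ)`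
of the Levi-Civita connection. -/
def christoffel (g : E4 → E4 →L[ℝ] E4 →L[ℝ] ℝ) (k i j : Fin 4) (p : E4) : ℝ :=
  (1 / 2) * ∑ l, (gram g p)⁻¹ k l *
    (pd i (fun q => gram g q j l) p + pd j (fun q => gram g q i l) p
      - pd l (fun q => gram g q i j) p)

/-- The components of the curvature tensor, `R(∂ᵢ, ∂ⱼ) ∂ₖ = ∑ l, riemannComp g l k i j ∂ₗ`, where
`R(X, Y) = [∇_X, ∇_Y] - ∇_[X, Y]`. -/
def riemannComp (g : E4 → E4 →L[ℝ] E4 →L[ℝ] ℝ) (l k i j : Fin 4) (p : E4) : ℝ :=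
  pd i (christoffel g l j k) p - pd j (christoffel g l i k) p
    + ∑ m, (christoffel g l i m p * christoffel g m j k p
      - christoffel g l j m p * christoffel g m i k p)

/-- The curvature operator `R(X, Y) Z` at `p`. -/
def riemann (g : E4 → E4 →L[ℝ] E4 →L[ℝ] ℝ) (p X Y Z : E4) : E4 :=
  fun l => ∑ k, ∑ i, ∑ j, riemannComp g l k i j p * X i * Y j * Z k

/-- The Ricci tensor `ρ(Y, Z) = tr (X ↦ R(X, Y) Z)` at `p`. -/
def ricci (g : E4 → E4 →L[ℝ] E4 →L[ℝ] ℝ) (p Y Z : E4) : ℝ :=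
  ∑ i, riemann g p (e i) Y Z i

/-! ### Hermitian and Kähler structures -/

/-- The vector field `J X`. -/
def appField (J : E4 → E4 →L[ℝ] E4) (X : E4 → E4) : E4 → E4 := fun q => J q (X q)

/-- The Nijenhuis tensor `N(X, Y) = [JX, JY] - J[JX, Y] - J[X, JY] - [X, Y]` of an almost complex
structure `J`, on vector fields `X`, `Y`. -/
def nijenhuis (J : E4 → E4 →L[ℝ] E4) (X Y : E4 → E4) (p : E4) : E4 :=
  VectorField.lieBracket ℝ (appField J X) (appField J Y) p
    - J p (VectorField.lieBracket ℝ (appField J X) Y p)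
    - J p (VectorField.lieBracket ℝ X (appField J Y) p)
    - VectorField.lieBracket ℝ X Y p

/-- `(M, g, J)` is a Hermitian manifold: `J` is a smooth `g`-orthogonal almost complex structure
whose Nijenhuis tensor vanishes. -/
structure IsHermitianOn (M : Set E4) (g : E4 → E4 →L[ℝ] E4 →L[ℝ] ℝ)
    (J : E4 → E4 →L[ℝ] E4) : Prop where
  metric : IsRiemannianMetricOn M g
  smooth : ContDiffOn ℝ ∞ J M
  sq : ∀ p ∈ M, ∀ X : E4, J p (J p X) = -X
  orthogonal : ∀ p ∈ M, ∀ X Y : E4, g p (J p X) (J p Y) = g p X Y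
  integrable : ∀ X Y : E4 → E4, ContDiffOn ℝ ∞ X M → ContDiffOn ℝ ∞ Y M →
    ∀ p ∈ M, nijenhuis J X Y p = 0

/-- `Ω` is the Kähler form of `(M, g, J)`: `Ω(X, Y) = g(JX, Y)`. -/
def IsKaehlerFormOn (M : Set E4) (g : E4 → E4 →L[ℝ] E4 →L[ℝ] ℝ) (J : E4 → E4 →L[ℝ] E4)
    (Ω : E4 → E4 [⋀^Fin 2]→L[ℝ] ℝ) : Prop :=
  ∀ p ∈ M, ∀ X Y : E4, Ω p ![X, Y] = g p (J p X) Y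

/-- `(M, g, J)` is Kähler: it is Hermitian and its Kähler form is closed. -/
def IsKaehlerOn (M : Set E4) (g : E4 → E4 →L[ℝ] E4 →L[ℝ] ℝ) (J : E4 → E4 →L[ℝ] E4) : Prop :=
  IsHermitianOn M g J ∧
    ∃ Ω : E4 → E4 [⋀^Fin 2]→L[ℝ] ℝ, IsKaehlerFormOn M g J Ω ∧ ∀ p ∈ M, extDeriv Ω p = 0

/-- `(M, g, J)` is locally conformally Kähler: every point of `M` has an open neighbourhood `W` on
which `f g` is Kähler with respect to `J` for some smooth positive function `f`. -/
def IsLocallyConformallyKaehlerOn (M : Set E4) (g : E4 → E4 →L[ℝ] E4 →L[ℝ] ℝ)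
    (J : E4 → E4 →L[ℝ] E4) : Prop :=
  ∀ p ∈ M, ∃ W : Set E4, IsOpen W ∧ p ∈ W ∧ W ⊆ M ∧
    ∃ f : E4 → ℝ, ContDiffOn ℝ ∞ f W ∧ (∀ q ∈ W, 0 < f q) ∧ IsKaehlerOn W (fun q => f q • g q) J

/-- `θ` is the Lee form of the Hermitian surface with Kähler form `Ω`: the (unique) one-form with
`dΩ = 2 θ ∧ Ω`. -/
def IsLeeFormOn (M : Set E4) (Ω : E4 → E4 [⋀^Fin 2]→L[ℝ] ℝ) (θ : E4 → E4 →L[ℝ] ℝ) : Prop :=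
  ∀ p ∈ M, ∀ η : E4 →L[ℝ] ℝ, extDeriv Ω p = (2 : ℝ) • wedge η (Ω p) ↔ η = θ p

/-- The Ricci tensor of `(M, g)` is `J`-invariant. -/
def HasInvariantRicciOn (M : Set E4) (g : E4 → E4 →L[ℝ] E4 →L[ℝ] ℝ)
    (J : E4 → E4 →L[ℝ] E4) : Prop :=
  ∀ p ∈ M, ∀ X Y : E4, ricci g p (J p X) (J p Y) = ricci g p X Y

/-- `b` is a `g`-orthonormal frame of the tangent space at `p`. -/
def IsOrthonormalAt (g : E4 → E4 →L[ℝ] E4 →L[ℝ] ℝ) (p : E4) (b : Fin 4 → E4) : Prop :=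
  ∀ i j, g p (b i) (b j) = if i = j then 1 else 0

/-- `w` is self-dual (`s = 1`) or anti-self-dual (`s = -1`), `∗w = s w`, for the metric and
orientation in which the frame `b` is orthonormal and positively oriented. -/
def IsDualInFrame (s : ℝ) (w : E4 [⋀^Fin 2]→L[ℝ] ℝ) (b : Fin 4 → E4) : Prop :=
  w ![b 2, b 3] = s * w ![b 0, b 1] ∧
  w ![b 3, b 1] = s * w ![b 0, b 2] ∧
  w ![b 1, b 2] = s * w ![b 0, b 3]

/-- The almost Hermitian structures with Kähler forms `Ω₁` and `Ω₂` are opposite on `(M, g)`: at each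
point there is an orientation for which `Ω₁` is self-dual and `Ω₂` is anti-self-dual. -/
def AreOppositeOn (M : Set E4) (g : E4 → E4 →L[ℝ] E4 →L[ℝ] ℝ)
    (Ω₁ Ω₂ : E4 → E4 [⋀^Fin 2]→L[ℝ] ℝ) : Prop :=
  ∀ p ∈ M, ∃ b : Fin 4 → E4, IsOrthonormalAt g p b ∧
    IsDualInFrame 1 (Ω₁ p) b ∧ IsDualInFrame (-1) (Ω₂ p) b

/-! ### QCH Kähler surfaces -/

/-- `D` is a smooth distribution of rank two on `M`. -/
def IsSmoothPlaneFieldOn (M : Set E4) (D : E4 → Submodule ℝ E4) : Prop :=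
  ∀ p ∈ M, Module.finrank ℝ (D p) = 2 ∧
    ∃ W : Set E4, IsOpen W ∧ p ∈ W ∧ W ⊆ M ∧ ∃ X Y : E4 → E4,
      ContDiffOn ℝ ∞ X W ∧ ContDiffOn ℝ ∞ Y W ∧ ∀ q ∈ W, D q = Submodule.span ℝ {X q, Y q}

/-- `P` is the `g`-orthogonal projection of `X` onto `D` at `p`. -/
def IsOrthProjAt (g : E4 → E4 →L[ℝ] E4 →L[ℝ] ℝ) (D : E4 → Submodule ℝ E4) (p X P : E4) : Prop :=
  P ∈ D p ∧ ∀ Q ∈ D p, g p (X - P) Q = 0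

/-- The holomorphic sectional curvature `R(X, JX, JX, X) = g(R(X, JX) JX, X)` of a unit vector `X`. -/
def holCurv (g : E4 → E4 →L[ℝ] E4 →L[ℝ] ℝ) (J : E4 → E4 →L[ℝ] E4) (p X : E4) : ℝ :=
  g p (riemann g p X (J p X) (J p X)) X

/-- `(M, g, J)` is a QCH Kähler surface with respect to the distribution `D`: it is Kähler, `D` is a
smooth `J`-invariant distribution of rank two, and the holomorphic sectional curvature of a unit
vector `X` depends only on the point and on `|X_D|`, with `X_D` the orthogonal projection to `D`. -/
structure IsQCHKaehlerOn (M : Set E4) (g : E4 → E4 →L[ℝ] E4 →L[ℝ] ℝ) (J : E4 → E4 →L[ℝ] E4)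
    (D : E4 → Submodule ℝ E4) : Prop where
  kaehler : IsKaehlerOn M g J
  smooth : IsSmoothPlaneFieldOn M D
  invariant : ∀ p ∈ M, ∀ X ∈ D p, J p X ∈ D p
  curvature : ∃ φ : E4 → ℝ → ℝ, ∀ p ∈ M, ∀ X P : E4, g p X X = 1 → IsOrthProjAt g D p X P →
    holCurv g J p X = φ p (Real.sqrt (g p P P))

/-! ### The family of metrics -/

/-- `∂f/∂x` for a function on the plane. -/
def pdx (f : ℝ × ℝ → ℝ) (q : ℝ × ℝ) : ℝ := fderiv ℝ f q (1, 0)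

/-- `∂f/∂y` for a function on the plane. -/
def pdy (f : ℝ × ℝ → ℝ) (q : ℝ × ℝ) : ℝ := fderiv ℝ f q (0, 1)

/-- The function `ln f`. -/
def lnf (f : ℝ × ℝ → ℝ) : ℝ × ℝ → ℝ := fun q => Real.log (f q)

/-- The projection `(x, y, z, t) ↦ (x, y)`. -/
def xy (p : E4) : ℝ × ℝ := (p 0, p 1)

/-- `M = U × {(z, t) : 0 < |z| < π / (2|a|)}`. -/
def domain (a : ℝ) (U : Set (ℝ × ℝ)) : Set E4 :=
  {p | xy p ∈ U ∧ 0 < |p 2| ∧ |p 2| < Real.pi / (2 * |a|)}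

/-- `l₂ = -(1/2a) (ln H)_y`. -/
def l₂ (a : ℝ) (H : ℝ × ℝ → ℝ) (q : ℝ × ℝ) : ℝ := -(1 / (2 * a)) * pdy (lnf H) q

/-- `n₂ = (1/2a) (ln H)_x`. -/
def n₂ (a : ℝ) (H : ℝ × ℝ → ℝ) (q : ℝ × ℝ) : ℝ := (1 / (2 * a)) * pdx (lnf H) q

/-- `θ₃ = sin 2az dt - (cos 2at cos 2az H + sin 2az l₂) dx - (- sin 2at cos 2az H + sin 2az n₂) dy`. -/
def θ₃ (a : ℝ) (H : ℝ × ℝ → ℝ) (p : E4) : E4 →L[ℝ] ℝ :=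
  Real.sin (2 * a * p 2) • dx 3
    - (Real.cos (2 * a * p 3) * Real.cos (2 * a * p 2) * H (xy p)
        + Real.sin (2 * a * p 2) * l₂ a H (xy p)) • dx 0
    - (-(Real.sin (2 * a * p 3)) * Real.cos (2 * a * p 2) * H (xy p)
        + Real.sin (2 * a * p 2) * n₂ a H (xy p)) • dx 1

/-- `θ₄ = dz - sin 2at H dx - cos 2at H dy`. -/
def θ₄ (a : ℝ) (H : ℝ × ℝ → ℝ) (p : E4) : E4 →L[ℝ] ℝ :=
  dx 2 - (Real.sin (2 * a * p 3) * H (xy p)) • dx 0 - (Real.cos (2 * a * p 3) * H (xy p)) • dx 1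

/-- The metric `g_Σ = h² (dx² + dy²)`, pulled back to `M`. -/
def gSigma (h : ℝ × ℝ → ℝ) (p : E4) : E4 →L[ℝ] E4 →L[ℝ] ℝ :=
  h (xy p) ^ 2 • (tensor (dx 0) (dx 0) + tensor (dx 1) (dx 1))

/-- The area form `ω_Σ = h² dx ∧ dy`, pulled back to `M`. -/
def areaSigma (h : ℝ × ℝ → ℝ) (p : E4) : E4 [⋀^Fin 2]→L[ℝ] ℝ :=
  h (xy p) ^ 2 • wedge₁ (dx 0) (dx 1)

/-- `g = (cos az)² g_Σ + θ₃ ⊗ θ₃ + θ₄ ⊗ θ₄`. -/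
def metric (a : ℝ) (h H : ℝ × ℝ → ℝ) (p : E4) : E4 →L[ℝ] E4 →L[ℝ] ℝ :=
  Real.cos (a * p 2) ^ 2 • gSigma h p
    + tensor (θ₃ a H p) (θ₃ a H p) + tensor (θ₄ a H p) (θ₄ a H p)

/-- `Ω̄ = (cos az)² ω_Σ + θ₄ ∧ θ₃`. -/
def ΩBar (a : ℝ) (h H : ℝ × ℝ → ℝ) (p : E4) : E4 [⋀^Fin 2]→L[ℝ] ℝ :=
  Real.cos (a * p 2) ^ 2 • areaSigma h p + wedge₁ (θ₄ a H p) (θ₃ a H p)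

/-- `Ω = (cos az)² ω_Σ + θ₃ ∧ θ₄`. -/
def Ω (a : ℝ) (h H : ℝ × ℝ → ℝ) (p : E4) : E4 [⋀^Fin 2]→L[ℝ] ℝ :=
  Real.cos (a * p 2) ^ 2 • areaSigma h p + wedge₁ (θ₃ a H p) (θ₄ a H p)

/-- The distribution spanned by `∂_z` and `∂_t`. -/
def vertical (_p : E4) : Submodule ℝ E4 := Submodule.span ℝ {e 2, e 3}

end

end KaehlerSurface

open KaehlerSurface

/-! The proof is Cartan's moving frame method. Besides θ₃ and θ₄ put θ₁ = cos(az) h dx and θ₂ =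
cos(az) h dy; these four forms are an orthonormal coframe, and every claim becomes an algebraic
statement about its connection and curvature forms.

The metric closes up because of three auxiliary forms. With φ + iψ = H e^{2iat}(dx + i dy) and γ =
dt - l₂ dx - n₂ dy, the choice of l₂, n₂ gives d(φ + iψ) = 2ia γ ∧ (φ + iψ), and the equation for Δ
ln H is exactly dγ = 2a φ ∧ ψ - a h² dx ∧ dy. Apart from the h² term these are Maurer-Cartan
equations of SU(2). Since θ₄ = dz - ψ, and θ₃ is one leg of the pair (γ, φ) rotated by an angle
depending on 2az, the structure equations and the connection matrix follow (`IsAdmissible.torsion`).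

The connection matrix commutes with J̄, so J̄ is parallel: this gives integrability and dΩ̄ = 0
together. Changing the sign of J̄ on the vertical plane gives J. It is not parallel, but ∇_{JV}J = J
∇_V J, which is integrability, and dΩ is read off from ∇J. In the curvature forms
(`IsAdmissible.curvForm_eq`) every coefficient is a constant multiple of a² except one function K.
Hence the Ricci tensor is a multiple of the metric on each of the two planes, so it is J-invariant,
and the holomorphic sectional curvature is a polynomial in the squared lengths of the two
components, which is the QCH property.

If f g were Kähler for J, then df = 4af tan(az) θ₄, so the right-hand side would be closed and dθ₄
would vanish on ker θ₄. But dθ₄ = -2a γ ∧ φ does not.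

The general half of the argument (`IsMovingFrameOn`) shows that the coordinate definitions of
Christoffel symbols, curvature, Nijenhuis tensor and exterior derivative agree with their frame
versions. -/

namespace KaehlerSurface

/-! ### Moving frames

An orthonormal coframe `θ` on an open subset of `ℝ⁴`, its dual frame `E`, and the connection forms
`w` of the Levi-Civita connection, characterised by skew-symmetry and `dθᵃ = -∑ wᵃ_b ∧ θᵇ`. -/

/-- `θ` is an orthonormal coframe of `g` with dual frame `E` and Levi-Civita connection forms `w`. -/
structure IsMovingFrameOn (M : Set E4) (g : E4 → E4 →L[ℝ] E4 →L[ℝ] ℝ)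
    (θ : Fin 4 → E4 → E4 →L[ℝ] ℝ) (E : Fin 4 → E4 → E4)
    (w : Fin 4 → Fin 4 → E4 → E4 →L[ℝ] ℝ) : Prop where
  isOpen : IsOpen M
  smooth_coframe : ∀ a, ContDiffOn ℝ ∞ (θ a) M
  smooth_frame : ∀ a, ContDiffOn ℝ ∞ (E a) M
  smooth_conn : ∀ a b, ContDiffOn ℝ ∞ (w a b) M
  dual : ∀ p ∈ M, ∀ a b, θ a p (E b p) = if a = b then 1 else 0
  metric_eq : ∀ p ∈ M, ∀ X Y, g p X Y = ∑ a, θ a p X * θ a p Y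
  skew : ∀ p ∈ M, ∀ a b X, w a b p X = -w b a p X
  torsion : ∀ p ∈ M, ∀ a X Y, fderiv ℝ (θ a) p X Y - fderiv ℝ (θ a) p Y X
    = ∑ b, (w a b p Y * θ b p X - w a b p X * θ b p Y)

/-- The components `θᵃ(∇_X Y)` of the covariant derivative of a constant vector field `Y`. -/
noncomputable def covDeriv (θ : Fin 4 → E4 → E4 →L[ℝ] ℝ) (w : Fin 4 → Fin 4 → E4 → E4 →L[ℝ] ℝ)
    (a : Fin 4) (p X Y : E4) : ℝ :=
  fderiv ℝ (θ a) p X Y + ∑ b, w a b p X * θ b p Y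

/-- The curvature forms `dwᵃ_b + ∑ wᵃ_c ∧ wᶜ_b`. -/
noncomputable def curvForm (w : Fin 4 → Fin 4 → E4 → E4 →L[ℝ] ℝ) (a b : Fin 4) (p X Y : E4) : ℝ :=
  fderiv ℝ (w a b) p X Y - fderiv ℝ (w a b) p Y X
    + ∑ c, (w a c p X * w c b p Y - w a c p Y * w c b p X)

lemma sum_smul_e (X : E4) : X = ∑ i, X i • e i := by
  ext j
  simp [e, Pi.single_apply]

lemma covector_apply (α : E4 →L[ℝ] ℝ) (X : E4) : α X = ∑ i, X i * α (e i) := by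
  conv_lhs => rw [sum_smul_e X]
  simp

lemma differentiableAt_of_contDiffOn {F : Type*} [NormedAddCommGroup F] [NormedSpace ℝ F]
    {M : Set E4} (hM : IsOpen M) {f : E4 → F} (hf : ContDiffOn ℝ ∞ f M) {p : E4} (hp : p ∈ M) :
    DifferentiableAt ℝ f p :=
  (hf.contDiffAt (hM.mem_nhds hp)).differentiableAt (by simp)

lemma fderiv_clm_apply_const {F : Type*} [NormedAddCommGroup F] [NormedSpace ℝ F]
    {α : E4 → E4 →L[ℝ] F} {p : E4} (hα : DifferentiableAt ℝ α p) (X V : E4) :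
    fderiv ℝ (fun q => α q X) p V = fderiv ℝ α p V X := by
  rw [fderiv_clm_apply hα (differentiableAt_const X)]
  simp

namespace IsMovingFrameOn

variable {M : Set E4} {g : E4 → E4 →L[ℝ] E4 →L[ℝ] ℝ} {θ : Fin 4 → E4 → E4 →L[ℝ] ℝ}
  {E : Fin 4 → E4 → E4} {w : Fin 4 → Fin 4 → E4 → E4 →L[ℝ] ℝ}

lemma coframe_mul_frame (hF : IsMovingFrameOn M g θ E w) {p : E4} (hp : p ∈ M) :
    (Matrix.of fun a i => θ a p (e i)) * (Matrix.of fun i a => E a p i)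
      = (1 : Matrix (Fin 4) (Fin 4) ℝ) := by
  ext a b
  rw [Matrix.mul_apply, Matrix.one_apply, ← hF.dual p hp a b, covector_apply (θ a p)]
  exact Finset.sum_congr rfl fun i _ => mul_comm _ _

lemma frame_mul_coframe (hF : IsMovingFrameOn M g θ E w) {p : E4} (hp : p ∈ M) :
    (Matrix.of fun i a => E a p i) * (Matrix.of fun a i => θ a p (e i))
      = (1 : Matrix (Fin 4) (Fin 4) ℝ) :=
  mul_eq_one_comm.mp (hF.coframe_mul_frame hp)

lemma expand (hF : IsMovingFrameOn M g θ E w) {p : E4} (hp : p ∈ M) (X : E4) :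
    X = ∑ a, θ a p X • E a p := by
  ext j
  have h := fun i => congrFun (congrFun (hF.frame_mul_coframe hp) j) i
  simp only [Matrix.mul_apply, Matrix.of_apply, Matrix.one_apply] at h
  simp only [Finset.sum_apply, Pi.smul_apply, smul_eq_mul]
  calc X j = ∑ i, X i * ∑ a, E a p j * θ a p (e i) := by simp [h]
    _ = ∑ a, (∑ i, X i * θ a p (e i)) * E a p j := by
        simp only [Finset.mul_sum, Finset.sum_mul]
        rw [Finset.sum_comm]
        exact Finset.sum_congr rfl fun a _ => Finset.sum_congr rfl fun i _ => by ring
    _ = ∑ a, θ a p X * E a p j :=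
        Finset.sum_congr rfl fun a _ => by rw [← covector_apply]

lemma ext_coframe (hF : IsMovingFrameOn M g θ E w) {p : E4} (hp : p ∈ M) {X Y : E4}
    (h : ∀ a, θ a p X = θ a p Y) : X = Y := by
  rw [hF.expand hp X, hF.expand hp Y]
  exact Finset.sum_congr rfl fun a _ => by rw [h a]

/-! ### The Levi-Civita connection in the frame. -/

/-- Constant vector fields commute, so the first structure equation says ∇_X Y = ∇_Y X for them. -/
lemma covDeriv_symm (hF : IsMovingFrameOn M g θ E w) {p : E4} (hp : p ∈ M) (a : Fin 4) (X Y : E4) :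
    covDeriv θ w a p X Y = covDeriv θ w a p Y X := by
  have h := hF.torsion p hp a X Y
  rw [Finset.sum_sub_distrib] at h
  simp only [covDeriv]
  linarith

lemma fderiv_coframe (a : Fin 4) (p X Y : E4) :
    fderiv ℝ (θ a) p X Y = covDeriv θ w a p X Y - ∑ b, w a b p X * θ b p Y := by
  simp [covDeriv]

lemma pd_gram (hF : IsMovingFrameOn M g θ E w) {p : E4} (hp : p ∈ M) (i j k : Fin 4) :
    pd i (fun q => gram g q j k) p
      = ∑ a, (fderiv ℝ (θ a) p (e i) (e j) * θ a p (e k)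
          + θ a p (e j) * fderiv ℝ (θ a) p (e i) (e k)) := by
  have hd : ∀ a, DifferentiableAt ℝ (θ a) p := fun a =>
    differentiableAt_of_contDiffOn hF.isOpen (hF.smooth_coframe a) hp
  have hd' : ∀ a (m : Fin 4), DifferentiableAt ℝ (fun q => θ a q (e m)) p := fun a m =>
    (hd a).clm_apply (differentiableAt_const _)
  have h : (fun q => gram g q j k) =ᶠ[nhds p] fun q => ∑ a, θ a q (e j) * θ a q (e k) := by
    filter_upwards [hF.isOpen.mem_nhds hp] with q hq
    simp [gram, hF.metric_eq q hq]
  rw [pd, h.fderiv_eq, fderiv_fun_sum fun a _ => (hd' a j).fun_mul (hd' a k)]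
  simp only [_root_.sum_apply]
  refine Finset.sum_congr rfl fun a _ => ?_
  rw [fderiv_fun_mul (hd' a j) (hd' a k)]
  simp only [_root_.add_apply, _root_.smul_apply, smul_eq_mul,
    fderiv_clm_apply_const (hd a)]
  ring

/-- This is the Koszul formula: metric compatibility expands each derivative of the metric, and
torsion-freeness merges the six resulting terms. -/
lemma christoffel_lowered (hF : IsMovingFrameOn M g θ E w) {p : E4} (hp : p ∈ M)
    (i j l : Fin 4) :
    pd i (fun q => gram g q j l) p + pd j (fun q => gram g q i l) p
      - pd l (fun q => gram g q i j) p
      = 2 * ∑ a, covDeriv θ w a p (e i) (e j) * θ a p (e l) := by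
  have compat : ∀ i j k, pd i (fun q => gram g q j k) p
      = ∑ a, (covDeriv θ w a p (e i) (e j) * θ a p (e k)
          + θ a p (e j) * covDeriv θ w a p (e i) (e k)) := by
    intro i j k
    rw [hF.pd_gram hp]
    -- Skew-symmetry of the connection matrix is metric compatibility: the connection terms cancel
    -- in pairs.
    have h0 : ∑ a, ((∑ b, w a b p (e i) * θ b p (e j)) * θ a p (e k)
        + θ a p (e j) * ∑ b, w a b p (e i) * θ b p (e k)) = 0 := by
      rw [Finset.sum_add_distrib]
      simp only [Finset.sum_mul, Finset.mul_sum]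
      rw [Finset.sum_comm, ← Finset.sum_add_distrib]
      refine Finset.sum_eq_zero fun a _ => ?_
      rw [← Finset.sum_add_distrib]
      refine Finset.sum_eq_zero fun b _ => ?_
      rw [hF.skew p hp b a]
      ring
    rw [← sub_eq_zero, ← Finset.sum_sub_distrib, ← neg_eq_zero, ← Finset.sum_neg_distrib, ← h0]
    refine Finset.sum_congr rfl fun a _ => ?_
    simp only [covDeriv]
    ring
  rw [compat, compat, compat, ← Finset.sum_add_distrib, ← Finset.sum_sub_distrib, Finset.mul_sum]
  refine Finset.sum_congr rfl fun a _ => ?_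
  rw [hF.covDeriv_symm hp a (e j) (e i), hF.covDeriv_symm hp a (e l) (e i),
    hF.covDeriv_symm hp a (e l) (e j)]
  ring

lemma christoffel_eq (hF : IsMovingFrameOn M g θ E w) {p : E4} (hp : p ∈ M) (k i j : Fin 4) :
    christoffel g k i j p = ∑ a, E a p k * covDeriv θ w a p (e i) (e j) := by
  set A : Matrix (Fin 4) (Fin 4) ℝ := Matrix.of fun a i => θ a p (e i) with hA
  set B : Matrix (Fin 4) (Fin 4) ℝ := Matrix.of fun i a => E a p i with hB
  have hAB : A * B = 1 := hF.coframe_mul_frame hp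
  -- With A the coframe matrix and B its inverse, the Gram matrix is AᵀA, so raising an index of Aᵀ
  -- gives B.
  have hBA : B * A = 1 := hF.frame_mul_coframe hp
  have hg : gram g p = A.transpose * A := by
    ext i j
    simp [gram, Matrix.mul_apply, hF.metric_eq p hp, hA]
  have hinv : (gram g p)⁻¹ = B * B.transpose := by
    refine Matrix.inv_eq_right_inv ?_
    rw [hg, Matrix.mul_assoc, ← Matrix.mul_assoc A, hAB, Matrix.one_mul, ← Matrix.transpose_mul,
      hBA, Matrix.transpose_one]
  have hBt : (gram g p)⁻¹ * A.transpose = B := by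
    rw [hinv, Matrix.mul_assoc, ← Matrix.transpose_mul, hAB, Matrix.transpose_one, Matrix.mul_one]
  simp only [christoffel, hF.christoffel_lowered hp]
  have h : ∀ a, E a p k = ∑ l, (gram g p)⁻¹ k l * θ a p (e l) := fun a => by
    have := congrFun (congrFun hBt k) a
    simpa [Matrix.mul_apply, hA, hB] using this.symm
  simp only [h, Finset.mul_sum, Finset.sum_mul]
  rw [Finset.sum_comm]
  exact Finset.sum_congr rfl fun a _ => Finset.sum_congr rfl fun l _ => by ring

lemma coframe_christoffel (hF : IsMovingFrameOn M g θ E w) {p : E4} (hp : p ∈ M)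
    (a i j : Fin 4) :
    ∑ l, θ a p (e l) * christoffel g l i j p = covDeriv θ w a p (e i) (e j) := by
  have h : ∑ l, θ a p (e l) * christoffel g l i j p
      = ∑ b, θ a p (E b p) * covDeriv θ w b p (e i) (e j) := by
    simp only [hF.christoffel_eq hp, covector_apply (θ a p) (E _ p), Finset.mul_sum,
      Finset.sum_mul]
    rw [Finset.sum_comm]
    exact Finset.sum_congr rfl fun a _ => Finset.sum_congr rfl fun l _ => by ring
  rw [h]
  simp [hF.dual p hp]

/-! ### Cartan's second structure equation. -/

lemma differentiableAt_coframe (hF : IsMovingFrameOn M g θ E w) {p : E4} (hp : p ∈ M)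
    (a : Fin 4) : DifferentiableAt ℝ (θ a) p :=
  differentiableAt_of_contDiffOn hF.isOpen (hF.smooth_coframe a) hp

lemma differentiableAt_conn (hF : IsMovingFrameOn M g θ E w) {p : E4} (hp : p ∈ M)
    (a b : Fin 4) : DifferentiableAt ℝ (w a b) p :=
  differentiableAt_of_contDiffOn hF.isOpen (hF.smooth_conn a b) hp

lemma differentiableAt_fderiv_coframe (hF : IsMovingFrameOn M g θ E w) {p : E4} (hp : p ∈ M)
    (a : Fin 4) : DifferentiableAt ℝ (fderiv ℝ (θ a)) p :=
  differentiableAt_of_contDiffOn hF.isOpen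
    ((hF.smooth_coframe a).fderiv_of_isOpen hF.isOpen (by simp)) hp

lemma differentiableAt_covDeriv (hF : IsMovingFrameOn M g θ E w) {p : E4} (hp : p ∈ M)
    (a : Fin 4) (X Y : E4) : DifferentiableAt ℝ (fun q => covDeriv θ w a q X Y) p := by
  have h1 := hF.differentiableAt_fderiv_coframe hp a
  have h2 := hF.differentiableAt_conn hp a
  have h3 := hF.differentiableAt_coframe hp
  unfold covDeriv
  fun_prop

lemma differentiableAt_christoffel (hF : IsMovingFrameOn M g θ E w) {p : E4} (hp : p ∈ M)
    (k i j : Fin 4) : DifferentiableAt ℝ (christoffel g k i j) p := by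
  have h : christoffel g k i j =ᶠ[nhds p]
      fun q => ∑ a, E a q k * covDeriv θ w a q (e i) (e j) := by
    filter_upwards [hF.isOpen.mem_nhds hp] with q hq
    exact hF.christoffel_eq hq k i j
  refine DifferentiableAt.congr_of_eventuallyEq ?_ h
  have h1 := fun a => hF.differentiableAt_covDeriv hp a (e i) (e j)
  have h2 : ∀ a, DifferentiableAt ℝ (fun q => E a q k) p := fun a =>
    differentiableAt_pi.mp (differentiableAt_of_contDiffOn hF.isOpen (hF.smooth_frame a) hp) k
  fun_prop

lemma fderiv_covDeriv (hF : IsMovingFrameOn M g θ E w) {p : E4} (hp : p ∈ M)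
    (a : Fin 4) (V X Y : E4) : fderiv ℝ (fun q => covDeriv θ w a q X Y) p V
      = fderiv ℝ (fderiv ℝ (θ a)) p V X Y
        + ∑ b, (fderiv ℝ (w a b) p V X * θ b p Y + w a b p X * fderiv ℝ (θ b) p V Y) := by
  have h1 := hF.differentiableAt_fderiv_coframe hp a
  have h2 := hF.differentiableAt_conn hp a
  have h3 := hF.differentiableAt_coframe hp
  have h1' : DifferentiableAt ℝ (fun q => fderiv ℝ (θ a) q X) p := by fun_prop
  have h2' : ∀ b, DifferentiableAt ℝ (fun q => w a b q X) p := by fun_prop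
  have h3' : ∀ b, DifferentiableAt ℝ (fun q => θ b q Y) p := by fun_prop
  unfold covDeriv
  rw [fderiv_fun_add (by fun_prop) (by fun_prop), _root_.add_apply,
    fderiv_clm_apply_const h1', fderiv_clm_apply_const h1,
    fderiv_fun_sum fun b _ => (h2' b).fun_mul (h3' b), _root_.sum_apply]
  congr 1
  refine Finset.sum_congr rfl fun b _ => ?_
  rw [fderiv_fun_mul (h2' b) (h3' b)]
  simp only [_root_.add_apply, _root_.smul_apply, smul_eq_mul,
    fderiv_clm_apply_const (h2 b), fderiv_clm_apply_const (h3 b)]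
  ring

/-- Both sides are the derivative along ∂ᵢ of the function θᵃ(∇ⱼ∂ₖ), computed once through the
Christoffel symbols and once through the connection forms. -/
lemma pd_coframe_christoffel (hF : IsMovingFrameOn M g θ E w) {p : E4} (hp : p ∈ M)
    (a i j k : Fin 4) :
    ∑ l, (fderiv ℝ (θ a) p (e i) (e l) * christoffel g l j k p
        + θ a p (e l) * pd i (christoffel g l j k) p)
      = fderiv ℝ (fderiv ℝ (θ a)) p (e i) (e j) (e k)
        + ∑ b, (fderiv ℝ (w a b) p (e i) (e j) * θ b p (e k)
          + w a b p (e j) * fderiv ℝ (θ b) p (e i) (e k)) := by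
  rw [← hF.fderiv_covDeriv hp]
  have h : (fun q => covDeriv θ w a q (e j) (e k)) =ᶠ[nhds p]
      fun q => ∑ l, θ a q (e l) * christoffel g l j k q := by
    filter_upwards [hF.isOpen.mem_nhds hp] with q hq
    exact (hF.coframe_christoffel hq a j k).symm
  have h1 : ∀ l, DifferentiableAt ℝ (fun q => θ a q (e l)) p := fun l =>
    (hF.differentiableAt_coframe hp a).clm_apply (differentiableAt_const _)
  have h2 := fun l => hF.differentiableAt_christoffel hp l j k
  rw [h.fderiv_eq, fderiv_fun_sum fun l _ => (h1 l).fun_mul (h2 l), _root_.sum_apply]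
  refine Finset.sum_congr rfl fun l _ => ?_
  rw [fderiv_fun_mul (h1 l) (h2 l)]
  simp only [_root_.add_apply, _root_.smul_apply, smul_eq_mul,
    fderiv_clm_apply_const (hF.differentiableAt_coframe hp a), pd]
  ring

/-- Antisymmetrising the derivative of θᵃ(∇ⱼ∂ₖ) in i and j leaves curvature on both sides, since the
second derivatives of θᵃ are symmetric. -/
lemma coframe_riemannComp (hF : IsMovingFrameOn M g θ E w) {p : E4} (hp : p ∈ M)
    (a i j k : Fin 4) :
    ∑ l, θ a p (e l) * riemannComp g l k i j p
      = ∑ b, curvForm w a b p (e i) (e j) * θ b p (e k) := by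
  have hs : fderiv ℝ (fderiv ℝ (θ a)) p (e i) (e j) = fderiv ℝ (fderiv ℝ (θ a)) p (e j) (e i) :=
    (((hF.smooth_coframe a).contDiffAt (hF.isOpen.mem_nhds hp)).isSymmSndFDerivAt
      (by rw [minSmoothness_of_isRCLikeNormedField]; exact WithTop.coe_le_coe.mpr (le_top (a := 2)))).eq _ _
  have hij := hF.pd_coframe_christoffel hp a i j k
  have hji := hF.pd_coframe_christoffel hp a j i k
  have hi := fun m => hF.coframe_christoffel hp a i m
  have hj := fun m => hF.coframe_christoffel hp a j m
  have hbi := fun b => hF.coframe_christoffel hp b i k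
  have hbj := fun b => hF.coframe_christoffel hp b j k
  simp only [covDeriv, Fin.sum_univ_four] at hij hji hi hj hbi hbj
  rw [hs] at hij
  simp only [riemannComp, curvForm, Fin.sum_univ_four]
  -- Weighting `hi m` by Γᵐⱼₖ trades the products of Christoffel symbols for derivatives of θᵃ,
  -- which cancel those in `hij`; `hbj` rewrites the remaining θᵇ(∇ⱼ∂ₖ) and produces w ∧ w. The
  -- negative terms are the same with i and j exchanged.
  linear_combination hij - hji
    + christoffel g 0 j k p * hi 0 + christoffel g 1 j k p * hi 1
    + christoffel g 2 j k p * hi 2 + christoffel g 3 j k p * hi 3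
    - christoffel g 0 i k p * hj 0 - christoffel g 1 i k p * hj 1
    - christoffel g 2 i k p * hj 2 - christoffel g 3 i k p * hj 3
    + w a 0 p (e i) * hbj 0 + w a 1 p (e i) * hbj 1
    + w a 2 p (e i) * hbj 2 + w a 3 p (e i) * hbj 3
    - w a 0 p (e j) * hbi 0 - w a 1 p (e j) * hbi 1
    - w a 2 p (e j) * hbi 2 - w a 3 p (e j) * hbi 3

end IsMovingFrameOn
-- Bilinearity is what allows curvature forms to be expanded in coordinate vectors, where the
-- structure equation was proved.
lemma exists_curvForm_eq (w : Fin 4 → Fin 4 → E4 → E4 →L[ℝ] ℝ) (a b : Fin 4) (p : E4) :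
    ∃ B : E4 →L[ℝ] E4 →L[ℝ] ℝ, ∀ X Y, curvForm w a b p X Y = B X Y := by
  refine ⟨fderiv ℝ (w a b) p - (fderiv ℝ (w a b) p).flip
    + ∑ c, (tensor (w a c p) (w c b p) - tensor (w c b p) (w a c p)), fun X Y => ?_⟩
  simp only [curvForm, tensor, _root_.add_apply, _root_.sub_apply, _root_.sum_apply,
    ContinuousLinearMap.flip_apply, ContinuousLinearMap.smulRight_apply, _root_.smul_apply,
    smul_eq_mul]
  congr 1
  exact Finset.sum_congr rfl fun c _ => by ring

lemma curvForm_sum_left (w : Fin 4 → Fin 4 → E4 → E4 →L[ℝ] ℝ) (a b : Fin 4) (p X Y : E4) :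
    curvForm w a b p X Y = ∑ i, X i * curvForm w a b p (e i) Y := by
  obtain ⟨B, hB⟩ := exists_curvForm_eq w a b p
  simp only [hB]
  exact covector_apply (B.flip Y) X

lemma curvForm_sum_right (w : Fin 4 → Fin 4 → E4 → E4 →L[ℝ] ℝ) (a b : Fin 4) (p X Y : E4) :
    curvForm w a b p X Y = ∑ i, Y i * curvForm w a b p X (e i) := by
  obtain ⟨B, hB⟩ := exists_curvForm_eq w a b p
  simp only [hB]
  exact covector_apply (B X) Y

/-! ### Endomorphism fields with constant matrix in the frame. -/

/-- The field of endomorphisms with constant matrix `j` in the frame `E`. -/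
noncomputable def frameEndo (θ : Fin 4 → E4 → E4 →L[ℝ] ℝ) (E : Fin 4 → E4 → E4)
    (j : Matrix (Fin 4) (Fin 4) ℝ) (p : E4) : E4 →L[ℝ] E4 :=
  ∑ a, ∑ b, j a b • (θ b p).smulRight (E a p)

/-- The commutator `[j, ω(V)]` of a constant matrix with the connection matrix. -/
noncomputable def connComm (j : Matrix (Fin 4) (Fin 4) ℝ) (w : Fin 4 → Fin 4 → E4 → E4 →L[ℝ] ℝ)
    (p V : E4) (a c : Fin 4) : ℝ :=
  ∑ b, (j a b * w b c p V - w a b p V * j b c)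

/-- The Nijenhuis tensor is tensorial: the derivatives of X and Y cancel because J² = -1, and only
derivatives of J survive. -/
lemma nijenhuis_eq {J : E4 → E4 →L[ℝ] E4} {X Y : E4 → E4} {p : E4}
    (hJ : DifferentiableAt ℝ J p) (hX : DifferentiableAt ℝ X p) (hY : DifferentiableAt ℝ Y p)
    (hsq : ∀ V, J p (J p V) = -V) :
    nijenhuis J X Y p = fderiv ℝ J p (J p (X p)) (Y p) - fderiv ℝ J p (J p (Y p)) (X p)
      + J p (fderiv ℝ J p (Y p) (X p)) - J p (fderiv ℝ J p (X p) (Y p)) := by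
  have hd : ∀ {Z : E4 → E4}, DifferentiableAt ℝ Z p → ∀ V,
      fderiv ℝ (appField J Z) p V = fderiv ℝ J p V (Z p) + J p (fderiv ℝ Z p V) := by
    intro Z hZ V
    unfold appField
    rw [fderiv_clm_apply hJ hZ]
    simp [add_comm]
  simp only [nijenhuis, VectorField.lieBracket_eq, hd hX, hd hY]
  simp only [appField, map_sub, map_add, hsq]
  abel

namespace IsMovingFrameOn

variable {M : Set E4} {g : E4 → E4 →L[ℝ] E4 →L[ℝ] ℝ} {θ : Fin 4 → E4 → E4 →L[ℝ] ℝ}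
  {E : Fin 4 → E4 → E4} {w : Fin 4 → Fin 4 → E4 → E4 →L[ℝ] ℝ} {j : Matrix (Fin 4) (Fin 4) ℝ}

lemma coframe_riemann (hF : IsMovingFrameOn M g θ E w) {p : E4} (hp : p ∈ M) (a : Fin 4)
    (X Y Z : E4) :
    θ a p (riemann g p X Y Z) = ∑ b, curvForm w a b p X Y * θ b p Z := by
  have h1 : ∀ b, curvForm w a b p X Y * θ b p Z
      = ∑ k, ∑ i, ∑ j, (curvForm w a b p (e i) (e j) * θ b p (e k)) * (X i * Y j * Z k) := by
    intro b
    rw [covector_apply (θ b p) Z, curvForm_sum_left, Finset.mul_sum]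
    refine Finset.sum_congr rfl fun k _ => ?_
    rw [Finset.sum_mul]
    refine Finset.sum_congr rfl fun i _ => ?_
    rw [curvForm_sum_right, Finset.mul_sum, Finset.sum_mul]
    exact Finset.sum_congr rfl fun j _ => by ring
  simp only [h1]
  rw [covector_apply (θ a p)]
  simp only [riemann, Finset.sum_mul]
  rw [Finset.sum_comm, Finset.sum_comm (s := Finset.univ (α := Fin 4)) (t := Finset.univ)
    (f := fun b k => ∑ i, ∑ j, curvForm w a b p (e i) (e j) * θ b p (e k) * (X i * Y j * Z k))]
  refine Finset.sum_congr rfl fun k _ => ?_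
  rw [Finset.sum_comm, Finset.sum_comm (s := Finset.univ (α := Fin 4)) (t := Finset.univ)
    (f := fun b i => ∑ j, curvForm w a b p (e i) (e j) * θ b p (e k) * (X i * Y j * Z k))]
  refine Finset.sum_congr rfl fun i _ => ?_
  rw [Finset.sum_comm, Finset.sum_comm (s := Finset.univ (α := Fin 4)) (t := Finset.univ)
    (f := fun b j => curvForm w a b p (e i) (e j) * θ b p (e k) * (X i * Y j * Z k))]
  refine Finset.sum_congr rfl fun j _ => ?_
  rw [← Finset.sum_mul, ← hF.coframe_riemannComp hp, Finset.sum_mul]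
  exact Finset.sum_congr rfl fun l _ => by ring

lemma metric_riemann (hF : IsMovingFrameOn M g θ E w) {p : E4} (hp : p ∈ M) (X Y Z W : E4) :
    g p (riemann g p X Y Z) W = ∑ a, (∑ b, curvForm w a b p X Y * θ b p Z) * θ a p W := by
  simp only [hF.metric_eq p hp, hF.coframe_riemann hp]

/-- The trace defining the Ricci tensor is moved from the coordinate basis to the frame. -/
lemma ricci_eq (hF : IsMovingFrameOn M g θ E w) {p : E4} (hp : p ∈ M) (Y Z : E4) :
    ricci g p Y Z = ∑ a, ∑ b, curvForm w a b p (E a p) Y * θ b p Z := by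
  have h : ∀ i, riemann g p (e i) Y Z i
      = ∑ a, (∑ b, curvForm w a b p (e i) Y * θ b p Z) * E a p i := by
    intro i
    conv_lhs => rw [hF.expand hp (riemann g p (e i) Y Z)]
    simp only [hF.coframe_riemann hp, Finset.sum_apply, Pi.smul_apply, smul_eq_mul]
  simp only [ricci, h]
  rw [Finset.sum_comm]
  refine Finset.sum_congr rfl fun a _ => ?_
  simp only [Finset.sum_mul]
  rw [Finset.sum_comm]
  refine Finset.sum_congr rfl fun b _ => ?_
  rw [curvForm_sum_left w a b p (E a p), Finset.sum_mul]
  exact Finset.sum_congr rfl fun i _ => by ring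

lemma coframe_frameEndo (hF : IsMovingFrameOn M g θ E w) {p : E4} (hp : p ∈ M) (a : Fin 4)
    (X : E4) : θ a p (frameEndo θ E j p X) = ∑ b, j a b * θ b p X := by
  simp [frameEndo, hF.dual p hp]

lemma smooth_frameEndo (hF : IsMovingFrameOn M g θ E w) : ContDiffOn ℝ ∞ (frameEndo θ E j) M := by
  unfold frameEndo
  exact ContDiffOn.sum fun a _ => ContDiffOn.sum fun b _ =>
    ((hF.smooth_coframe b).smulRight (hF.smooth_frame a)).const_smul _

lemma frameEndo_sq (hF : IsMovingFrameOn M g θ E w) (hj : j * j = -1) {p : E4} (hp : p ∈ M)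
    (X : E4) : frameEndo θ E j p (frameEndo θ E j p X) = -X := by
  refine hF.ext_coframe hp fun a => ?_
  simp only [hF.coframe_frameEndo hp, map_neg, Finset.mul_sum]
  rw [Finset.sum_comm]
  have h : ∀ c, ∑ b, j a b * (j b c * θ c p X) = (-1 : Matrix (Fin 4) (Fin 4) ℝ) a c * θ c p X := by
    intro c
    rw [← hj, Matrix.mul_apply, Finset.sum_mul]
    exact Finset.sum_congr rfl fun b _ => by ring
  simp [h, Matrix.one_apply]

lemma frameEndo_orthogonal (hF : IsMovingFrameOn M g θ E w) (hj : j.transpose * j = 1) {p : E4}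
    (hp : p ∈ M) (X Y : E4) :
    g p (frameEndo θ E j p X) (frameEndo θ E j p Y) = g p X Y := by
  simp only [hF.metric_eq p hp, hF.coframe_frameEndo hp]
  have h : ∀ b c, ∑ a, j a b * j a c = if b = c then 1 else 0 := by
    intro b c
    have := congrFun (congrFun hj b) c
    simpa [Matrix.mul_apply, Matrix.one_apply] using this
  simp only [Finset.sum_mul_sum]
  rw [Finset.sum_comm]
  refine Finset.sum_congr rfl fun b _ => ?_
  rw [Finset.sum_comm]
  have h2 : ∀ c, ∑ a, j a b * θ b p X * (j a c * θ c p Y)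
      = (if b = c then 1 else 0) * (θ b p X * θ c p Y) := by
    intro c
    rw [← h, Finset.sum_mul]
    exact Finset.sum_congr rfl fun a _ => by ring
  simp [h2]

lemma isRiemannianMetricOn (hF : IsMovingFrameOn M g θ E w) (hg : ContDiffOn ℝ ∞ g M) :
    IsRiemannianMetricOn M g where
  smooth := hg
  symm p hp X Y := by
    simp only [hF.metric_eq p hp]
    exact Finset.sum_congr rfl fun a _ => mul_comm _ _
  pos p hp X hX := by
    rw [hF.metric_eq p hp]
    by_contra hc
    refine hX (hF.ext_coframe hp fun a => ?_)
    have h0 : ∑ a, θ a p X * θ a p X = 0 :=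
      le_antisymm (not_lt.mp hc) (Finset.sum_nonneg fun a _ => mul_self_nonneg _)
    have := (Finset.sum_eq_zero_iff_of_nonneg fun a _ => mul_self_nonneg _).mp h0 a
      (Finset.mem_univ _)
    simpa using this

/-- Since the matrix of J is constant, ∇_V J has matrix -[j, ω(V)]. The other two terms are J∇_V X
and ∇_V of the constant extension of JX, which convert ∇_V J into the flat derivative. -/
lemma coframe_fderiv_frameEndo (hF : IsMovingFrameOn M g θ E w) {p : E4} (hp : p ∈ M)
    (a : Fin 4) (V X : E4) :
    θ a p (fderiv ℝ (frameEndo θ E j) p V X)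
      = ∑ b, j a b * covDeriv θ w b p V X - covDeriv θ w a p V (frameEndo θ E j p X)
        - ∑ c, connComm j w p V a c * θ c p X := by
  have hJ : DifferentiableAt ℝ (frameEndo θ E j) p :=
    differentiableAt_of_contDiffOn hF.isOpen hF.smooth_frameEndo hp
  have hθ := hF.differentiableAt_coframe hp
  have hθ' : ∀ b, DifferentiableAt ℝ (fun q => j a b * θ b q X) p := by fun_prop
  have h : (fun q => θ a q (frameEndo θ E j q X)) =ᶠ[nhds p] fun q => ∑ b, j a b * θ b q X := by
    filter_upwards [hF.isOpen.mem_nhds hp] with q hq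
    exact hF.coframe_frameEndo hq a X
  have h2 := DFunLike.congr_fun (h.fderiv_eq (𝕜 := ℝ)) V
  rw [fderiv_clm_apply (hθ a) (by fun_prop), fderiv_fun_sum fun b _ => hθ' b] at h2
  simp only [_root_.add_apply, ContinuousLinearMap.comp_apply, ContinuousLinearMap.flip_apply,
    fderiv_clm_apply_const hJ, _root_.sum_apply] at h2
  have h3 : ∀ b, fderiv ℝ (fun q => j a b * θ b q X) p V = j a b * fderiv ℝ (θ b) p V X := by
    intro b
    rw [fderiv_const_mul (by fun_prop)]
    simp [fderiv_clm_apply_const (hθ b)]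
  simp only [h3] at h2
  rw [← eq_sub_iff_add_eq] at h2
  rw [h2]
  simp only [covDeriv, connComm, hF.coframe_frameEndo hp, Fin.sum_univ_four]
  ring

/-- Up to sign, `hint` is the vanishing of (∇_{JX}J)Y - (∇_{JY}J)X + J(∇_Y J)X - J(∇_X J)Y, the
Nijenhuis tensor written with a torsion-free connection. -/
lemma isHermitianOn_frameEndo (hF : IsMovingFrameOn M g θ E w) (hg : ContDiffOn ℝ ∞ g M)
    (hsq : j * j = -1) (horth : j.transpose * j = 1)
    (hint : ∀ p ∈ M, ∀ X Y a,
      ∑ c, (connComm j w p (frameEndo θ E j p X) a c * θ c p Y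
        - connComm j w p (frameEndo θ E j p Y) a c * θ c p X)
      + ∑ b, j a b * ∑ c, (connComm j w p Y b c * θ c p X - connComm j w p X b c * θ c p Y) = 0) :
    IsHermitianOn M g (frameEndo θ E j) where
  metric := hF.isRiemannianMetricOn hg
  smooth := hF.smooth_frameEndo
  sq p hp X := hF.frameEndo_sq hsq hp X
  orthogonal p hp X Y := hF.frameEndo_orthogonal horth hp X Y
  integrable X Y hX hY p hp := by
    rw [nijenhuis_eq (differentiableAt_of_contDiffOn hF.isOpen hF.smooth_frameEndo hp)
      (differentiableAt_of_contDiffOn hF.isOpen hX hp)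
      (differentiableAt_of_contDiffOn hF.isOpen hY hp) (hF.frameEndo_sq hsq hp)]
    refine hF.ext_coframe hp fun a => ?_
    have h := hint p hp (X p) (Y p) a
    simp only [map_add, map_sub, map_zero, hF.coframe_frameEndo hp,
      hF.coframe_fderiv_frameEndo hp]
    -- Torsion-freeness brings all covariant derivatives to one order of arguments, after which they
    -- cancel and only commutator terms remain.
    simp only [hF.covDeriv_symm hp _ (Y p) (X p), hF.covDeriv_symm hp _ (Y p) (frameEndo θ E j p _),
      hF.covDeriv_symm hp _ (X p) (frameEndo θ E j p _),
      hF.covDeriv_symm hp _ (frameEndo θ E j p (Y p)) (frameEndo θ E j p (X p))]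
    simp only [mul_sub, Finset.sum_sub_distrib] at h ⊢
    linarith

lemma isKaehlerFormOn_frameEndo (hF : IsMovingFrameOn M g θ E w)
    {Ω : E4 → E4 [⋀^Fin 2]→L[ℝ] ℝ}
    (hΩ : ∀ p ∈ M, ∀ X Y, Ω p ![X, Y] = ∑ a, (∑ b, j a b * θ b p X) * θ a p Y) :
    IsKaehlerFormOn M g (frameEndo θ E j) Ω := by
  intro p hp X Y
  simp only [hΩ p hp, hF.metric_eq p hp, hF.coframe_frameEndo hp]

/-- For a torsion-free connection dΩ is the alternating sum of ∇Ω, and (∇_V Ω)(X, Y) = g((∇_V J)X,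
Y) is minus the commutator term. -/
lemma extDeriv_apply_of_frame (hF : IsMovingFrameOn M g θ E w) (hj : j.transpose = -j)
    {Ω : E4 → E4 [⋀^Fin 2]→L[ℝ] ℝ} {p : E4} (hp : p ∈ M) (hd : DifferentiableAt ℝ Ω p)
    (hΩ : ∀ p ∈ M, ∀ X Y, Ω p ![X, Y] = ∑ a, (∑ b, j a b * θ b p X) * θ a p Y) (X Y Z : E4) :
    extDeriv Ω p ![X, Y, Z]
      = -(∑ a, (∑ c, connComm j w p X a c * θ c p Y) * θ a p Z
        - ∑ a, (∑ c, connComm j w p Y a c * θ c p X) * θ a p Z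
        + ∑ a, (∑ c, connComm j w p Z a c * θ c p X) * θ a p Y) := by
  have hθ := hF.differentiableAt_coframe hp
  have hS : ∀ V X Y, fderiv ℝ (fun q => Ω q ![X, Y]) p V
      = ∑ a, (∑ b, j a b * fderiv ℝ (θ b) p V X) * θ a p Y
        + ∑ a, (∑ b, j a b * θ b p X) * fderiv ℝ (θ a) p V Y := by
    intro V X Y
    have h : (fun q => Ω q ![X, Y]) =ᶠ[nhds p]
        fun q => ∑ a, (∑ b, j a b * θ b q X) * θ a q Y := by
      filter_upwards [hF.isOpen.mem_nhds hp] with q hq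
      exact hΩ q hq X Y
    have h1 : ∀ a, DifferentiableAt ℝ (fun q => ∑ b, j a b * θ b q X) p := by fun_prop
    have h2 : ∀ a, DifferentiableAt ℝ (fun q => θ a q Y) p := by fun_prop
    have h3 : ∀ a b, DifferentiableAt ℝ (fun q => j a b * θ b q X) p := by fun_prop
    have h4 : ∀ a, fderiv ℝ (fun q => ∑ b, j a b * θ b q X) p V
        = ∑ b, j a b * fderiv ℝ (θ b) p V X := by
      intro a
      rw [fderiv_fun_sum fun b _ => h3 a b, _root_.sum_apply]
      refine Finset.sum_congr rfl fun b _ => ?_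
      rw [fderiv_const_mul (by fun_prop)]
      simp [fderiv_clm_apply_const (hθ b)]
    rw [h.fderiv_eq, fderiv_fun_sum fun a _ => (h1 a).fun_mul (h2 a), _root_.sum_apply,
      ← Finset.sum_add_distrib]
    refine Finset.sum_congr rfl fun a _ => ?_
    rw [fderiv_fun_mul (h1 a) (h2 a)]
    simp only [_root_.add_apply, _root_.smul_apply, smul_eq_mul, h4,
      fderiv_clm_apply_const (hθ a)]
    ring
  have hv0 : Fin.removeNth 0 ![X, Y, Z] = ![Y, Z] := by ext i; fin_cases i <;> rfl
  have hv1 : Fin.removeNth 1 ![X, Y, Z] = ![X, Z] := by ext i; fin_cases i <;> rfl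
  have hv2 : Fin.removeNth 2 ![X, Y, Z] = ![X, Y] := by ext i; fin_cases i <;> rfl
  have hjs : ∀ a b, j b a = -j a b := fun a b => congrFun (congrFun hj a) b
  -- Leibniz rule for constant X, Y: V(Ω(X, Y)) = Ω(∇_V X, Y) + Ω(X, ∇_V Y) + (∇_V Ω)(X, Y).
  -- Skewness of `j` puts the second term in the form shown.
  have hS' : ∀ V X Y, fderiv ℝ (fun q => Ω q ![X, Y]) p V
      = ∑ a, (∑ b, j a b * covDeriv θ w b p V X) * θ a p Y
        - ∑ a, (∑ b, j a b * covDeriv θ w b p V Y) * θ a p X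
        - ∑ a, (∑ c, connComm j w p V a c * θ c p X) * θ a p Y := by
    intro V X Y
    have hB : ∑ a, (∑ b, j a b * covDeriv θ w b p V Y) * θ a p X
        = -∑ a, (∑ b, j a b * θ b p X) * covDeriv θ w a p V Y := by
      simp only [Finset.sum_mul, ← Finset.sum_neg_distrib]
      rw [Finset.sum_comm]
      exact Finset.sum_congr rfl fun a _ => Finset.sum_congr rfl fun b _ => by rw [hjs a b]; ring
    have hw : ∀ a b, w a b p V = -w b a p V := fun a b => hF.skew p hp a b V
    have hC : ∑ a, (∑ b, j a b * θ b p X) * ∑ c, w a c p V * θ c p Y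
        = -∑ a, (∑ c, (∑ b, w a b p V * j b c) * θ c p X) * θ a p Y := by
      simp only [Finset.sum_mul, Finset.mul_sum, ← Finset.sum_neg_distrib]
      calc _ = ∑ a, ∑ c, ∑ b, w a c p V * θ c p Y * (j a b * θ b p X) := ?_
        _ = ∑ c, ∑ a, ∑ b, w a c p V * θ c p Y * (j a b * θ b p X) := Finset.sum_comm
        _ = _ := ?_
      · exact Finset.sum_congr rfl fun a _ => Finset.sum_congr rfl fun c _ =>
          Finset.sum_congr rfl fun b _ => mul_comm _ _
      · refine Finset.sum_congr rfl fun c _ => ?_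
        rw [Finset.sum_comm]
        refine Finset.sum_congr rfl fun b _ => Finset.sum_congr rfl fun a _ => ?_
        rw [hw a c]
        ring
    rw [hS, hB]
    simp only [fderiv_coframe (w := w), connComm, mul_sub, sub_mul, Finset.sum_sub_distrib]
    rw [hC]
    simp only [Fin.sum_univ_four]
    ring
  rw [extDeriv_apply hd]
  refine (Fin.sum_univ_three _).trans ?_
  rw [hv0, hv1, hv2]
  simp only [Matrix.cons_val, hS', hF.covDeriv_symm hp _ Y X,
    hF.covDeriv_symm hp _ Z X, hF.covDeriv_symm hp _ Z Y]
  norm_num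
  ring

end IsMovingFrameOn
/-! ### Exterior derivatives of one-forms -/

/-- The exterior derivative `dα(X, Y)` of a one-form. -/
noncomputable def ext₁ (α : E4 → E4 →L[ℝ] ℝ) (p X Y : E4) : ℝ :=
  fderiv ℝ α p X Y - fderiv ℝ α p Y X

/-- The wedge product `(α ∧ β)(X, Y)` of covectors. -/
def wd (α β : E4 →L[ℝ] ℝ) (X Y : E4) : ℝ := α X * β Y - α Y * β X

section ext₁

variable {α β : E4 → E4 →L[ℝ] ℝ} {f : E4 → ℝ} {p : E4}

lemma ext₁_add (hα : DifferentiableAt ℝ α p) (hβ : DifferentiableAt ℝ β p) (X Y : E4) :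
    ext₁ (fun q => α q + β q) p X Y = ext₁ α p X Y + ext₁ β p X Y := by
  simp only [ext₁, fderiv_fun_add hα hβ, _root_.add_apply]
  ring

lemma ext₁_sub (hα : DifferentiableAt ℝ α p) (hβ : DifferentiableAt ℝ β p) (X Y : E4) :
    ext₁ (fun q => α q - β q) p X Y = ext₁ α p X Y - ext₁ β p X Y := by
  simp only [ext₁, fderiv_fun_sub hα hβ, _root_.sub_apply]
  ring

lemma ext₁_neg (X Y : E4) : ext₁ (fun q => -α q) p X Y = -ext₁ α p X Y := by
  simp only [ext₁, fderiv_fun_neg, _root_.neg_apply]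
  ring

lemma ext₁_const (c : E4 →L[ℝ] ℝ) (X Y : E4) : ext₁ (fun _ => c) p X Y = 0 := by
  simp [ext₁]

lemma ext₁_smul (hf : DifferentiableAt ℝ f p) (hα : DifferentiableAt ℝ α p) (X Y : E4) :
    ext₁ (fun q => f q • α q) p X Y
      = fderiv ℝ f p X * α p Y - fderiv ℝ f p Y * α p X + f p * ext₁ α p X Y := by
  simp only [ext₁, fderiv_fun_smul hf hα, _root_.add_apply, _root_.smul_apply, smul_eq_mul,
    ContinuousLinearMap.smulRight_apply]
  ring

lemma ext₁_smul_const (hf : DifferentiableAt ℝ f p) (c : E4 →L[ℝ] ℝ) (X Y : E4) :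
    ext₁ (fun q => f q • c) p X Y = fderiv ℝ f p X * c Y - fderiv ℝ f p Y * c X := by
  rw [ext₁_smul hf (differentiableAt_const c), ext₁_const]
  ring

end ext₁

@[simp] lemma dx_apply (i : Fin 4) (X : E4) : dx i X = X i := rfl

/-! ### Functions pulled back from the base and functions of `z`, `t` -/

section scalars

variable {a : ℝ} {U : Set (ℝ × ℝ)} {f : ℝ × ℝ → ℝ} {p : E4}

lemma contDiff_xy : ContDiff ℝ ∞ xy := by
  unfold xy
  fun_prop

lemma isOpen_domain (hU : IsOpen U) : IsOpen (domain a U) := by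
  have h2 : Continuous fun p : E4 => |p 2| := by fun_prop
  exact (hU.preimage contDiff_xy.continuous).inter
    ((isOpen_lt continuous_const h2).inter (isOpen_lt h2 continuous_const))

lemma smooth_comp_xy (hf : ContDiffOn ℝ ∞ f U) :
    ContDiffOn ℝ ∞ (fun p => f (xy p)) (domain a U) :=
  hf.comp contDiff_xy.contDiffOn fun _ hp => hp.1

lemma fderiv_comp_xy (hf : DifferentiableAt ℝ f (xy p)) (X : E4) :
    fderiv ℝ (fun q => f (xy q)) p X = pdx f (xy p) * X 0 + pdy f (xy p) * X 1 := by
  have hxy : HasFDerivAt xy ((dx 0).prod (dx 1)) p := ((dx 0).prod (dx 1)).hasFDerivAt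
  have h := (hf.hasFDerivAt.comp p hxy).fderiv
  have h' : fderiv ℝ (fun q => f (xy q)) p = (fderiv ℝ f (xy p)).comp ((dx 0).prod (dx 1)) := h
  have hX : (X 0, X 1) = X 0 • ((1 : ℝ), (0 : ℝ)) + X 1 • ((0 : ℝ), (1 : ℝ)) := by simp
  rw [h']
  simp only [ContinuousLinearMap.comp_apply, ContinuousLinearMap.prod_apply, dx_apply, pdx, pdy]
  rw [hX, map_add, map_smul, map_smul, smul_eq_mul, smul_eq_mul]
  ring

lemma differentiableAt_of_contDiffOn_base (hU : IsOpen U) (hf : ContDiffOn ℝ ∞ f U)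
    {q : ℝ × ℝ} (hq : q ∈ U) : DifferentiableAt ℝ f q :=
  (hf.contDiffAt (hU.mem_nhds hq)).differentiableAt (by simp)

lemma smooth_lnf (hf : ContDiffOn ℝ ∞ f U) (hpos : ∀ q ∈ U, 0 < f q) :
    ContDiffOn ℝ ∞ (lnf f) U :=
  hf.log fun q hq => (hpos q hq).ne'

lemma smooth_pdx (hU : IsOpen U) (hf : ContDiffOn ℝ ∞ f U) : ContDiffOn ℝ ∞ (pdx f) U :=
  (hf.fderiv_of_isOpen hU (by simp)).clm_apply contDiffOn_const

lemma smooth_pdy (hU : IsOpen U) (hf : ContDiffOn ℝ ∞ f U) : ContDiffOn ℝ ∞ (pdy f) U :=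
  (hf.fderiv_of_isOpen hU (by simp)).clm_apply contDiffOn_const

lemma pdx_eq_mul_pdx_lnf {q : ℝ × ℝ} (hf : DifferentiableAt ℝ f q) (h0 : 0 < f q) :
    pdx f q = f q * pdx (lnf f) q := by
  unfold pdx lnf
  rw [fderiv.log hf h0.ne', _root_.smul_apply, smul_eq_mul, mul_inv_cancel_left₀ h0.ne']

lemma pdy_eq_mul_pdy_lnf {q : ℝ × ℝ} (hf : DifferentiableAt ℝ f q) (h0 : 0 < f q) :
    pdy f q = f q * pdy (lnf f) q := by
  unfold pdy lnf
  rw [fderiv.log hf h0.ne', _root_.smul_apply, smul_eq_mul, mul_inv_cancel_left₀ h0.ne']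

lemma hasFDerivAt_coord (b : ℝ) (i : Fin 4) (p : E4) :
    HasFDerivAt (fun q : E4 => b * q i) (b • dx i) p :=
  ((dx i).hasFDerivAt (x := p)).const_mul b

lemma fderiv_cos_coord (b : ℝ) (i : Fin 4) (p X : E4) :
    fderiv ℝ (fun q : E4 => Real.cos (b * q i)) p X = -(b * Real.sin (b * p i) * X i) := by
  rw [(hasFDerivAt_coord b i p).cos.fderiv]
  simp
  ring

lemma fderiv_sin_coord (b : ℝ) (i : Fin 4) (p X : E4) :
    fderiv ℝ (fun q : E4 => Real.sin (b * q i)) p X = b * Real.cos (b * p i) * X i := by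
  rw [(hasFDerivAt_coord b i p).sin.fderiv]
  simp
  ring

lemma fderiv_tan_coord {b : ℝ} {i : Fin 4} {p : E4} (hc : Real.cos (b * p i) ≠ 0) (X : E4) :
    fderiv ℝ (fun q : E4 => Real.tan (b * q i)) p X
      = b * (1 + Real.tan (b * p i) ^ 2) * X i := by
  have h := (Real.hasDerivAt_tan hc).comp_hasFDerivAt p (hasFDerivAt_coord b i p)
  have h' : fderiv ℝ (fun q : E4 => Real.tan (b * q i)) p = _ := h.fderiv
  rw [h', ← Real.inv_one_add_tan_sq hc]
  simp
  ring

lemma cos_pos_of_mem_domain (ha : a ≠ 0) (hp : p ∈ domain a U) : 0 < Real.cos (a * p 2) := by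
  have h := hp.2.2
  rw [lt_div_iff₀ (by positivity)] at h
  have h2 : |a * p 2| < Real.pi / 2 := by rw [abs_mul]; linarith
  rw [abs_lt] at h2
  exact Real.cos_pos_of_mem_Ioo ⟨by linarith, h2.2⟩

/-- This is where z ≠ 0 is needed: it keeps sin 2az nonzero, so that θ₃ has a ∂_t component, and it
keeps the Lee form nonzero. -/
lemma tan_ne_zero_of_mem_domain (ha : a ≠ 0) (hp : p ∈ domain a U) : Real.tan (a * p 2) ≠ 0 := by
  have h := hp.2.2
  rw [lt_div_iff₀ (by positivity)] at h
  have h2 : |a * p 2| < Real.pi / 2 := by rw [abs_mul]; linarith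
  rw [abs_lt] at h2
  have h0 : a * p 2 ≠ 0 := mul_ne_zero ha (abs_pos.mp hp.2.1)
  rcases lt_or_gt_of_ne h0 with h3 | h3
  · exact (Real.tan_neg_of_neg_of_pi_div_two_lt h3 (by linarith)).ne
  · exact (Real.tan_pos_of_pos_of_lt_pi_div_two h3 h2.2).ne'


end scalars
/-! ### The orthonormal coframe of the metric and its connection forms -/

/-- The data `(a, U, h, H)` defining a metric of the family. -/
structure IsAdmissible (a : ℝ) (U : Set (ℝ × ℝ)) (h H : ℝ × ℝ → ℝ) : Prop where
  ne_zero : a ≠ 0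
  isOpen : IsOpen U
  smooth_h : ContDiffOn ℝ ∞ h U
  smooth_H : ContDiffOn ℝ ∞ H U
  h_pos : ∀ q ∈ U, 0 < h q
  H_pos : ∀ q ∈ U, 0 < H q
  laplace : ∀ q ∈ U, pdx (pdx (lnf H)) q + pdy (pdy (lnf H)) q
    = 2 * a ^ 2 * h q ^ 2 - 4 * a ^ 2 * H q ^ 2

noncomputable section

/-- `φ = H (cos 2at dx - sin 2at dy)`. -/
def φForm (a : ℝ) (H : ℝ × ℝ → ℝ) (p : E4) : E4 →L[ℝ] ℝ :=
  (Real.cos (2 * a * p 3) * H (xy p)) • dx 0 - (Real.sin (2 * a * p 3) * H (xy p)) • dx 1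

/-- `ψ = H (sin 2at dx + cos 2at dy)`. -/
def ψForm (a : ℝ) (H : ℝ × ℝ → ℝ) (p : E4) : E4 →L[ℝ] ℝ :=
  (Real.sin (2 * a * p 3) * H (xy p)) • dx 0 + (Real.cos (2 * a * p 3) * H (xy p)) • dx 1

/-- `γ = dt - l₂ dx - n₂ dy`. -/
def γForm (a : ℝ) (H : ℝ × ℝ → ℝ) (p : E4) : E4 →L[ℝ] ℝ :=
  dx 3 - l₂ a H (xy p) • dx 0 - n₂ a H (xy p) • dx 1

/-- `κ = -(ln h)_y dx + (ln h)_x dy`, the connection form of `g_Σ` up to sign. -/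
def κForm (h : ℝ × ℝ → ℝ) (p : E4) : E4 →L[ℝ] ℝ :=
  pdx (lnf h) (xy p) • dx 1 - pdy (lnf h) (xy p) • dx 0

/-- `θ₁ = cos az h dx`. -/
def θ₁ (a : ℝ) (h : ℝ × ℝ → ℝ) (p : E4) : E4 →L[ℝ] ℝ :=
  (Real.cos (a * p 2) * h (xy p)) • dx 0

/-- `θ₂ = cos az h dy`. -/
def θ₂ (a : ℝ) (h : ℝ × ℝ → ℝ) (p : E4) : E4 →L[ℝ] ℝ :=
  (Real.cos (a * p 2) * h (xy p)) • dx 1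

/-- `cos 2az γ + sin 2az φ`, which is `1/2a` times the connection form of the vertical
distribution. -/
def θHat (a : ℝ) (H : ℝ × ℝ → ℝ) (p : E4) : E4 →L[ℝ] ℝ :=
  Real.cos (2 * a * p 2) • γForm a H p + Real.sin (2 * a * p 2) • φForm a H p

/-- The pair (θ₃, `θHat`) is a rotation of (γ, φ), so θ₃ ∧ `θHat` = γ ∧ φ. -/
lemma θ₃_eq (a : ℝ) (H : ℝ × ℝ → ℝ) : θ₃ a H = fun p =>
    Real.sin (2 * a * p 2) • γForm a H p - Real.cos (2 * a * p 2) • φForm a H p := by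
  ext p X
  simp [θ₃, γForm, φForm]
  ring

lemma θ₄_eq (a : ℝ) (H : ℝ × ℝ → ℝ) : θ₄ a H = fun p => dx 2 - ψForm a H p := by
  ext p X
  simp [θ₄, ψForm]
  ring

/-- The connection form `ω¹₂`. -/
def conn₁₂ (a : ℝ) (h H : ℝ × ℝ → ℝ) (p : E4) : E4 →L[ℝ] ℝ :=
  (a * Real.tan (a * p 2)) • (θ₃ a H p - φForm a H p) - κForm h p

/-- The orthonormal coframe. -/
def coframe (a : ℝ) (h H : ℝ × ℝ → ℝ) (i : Fin 4) (p : E4) : E4 →L[ℝ] ℝ :=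
  ![θ₁ a h p, θ₂ a h p, θ₃ a H p, θ₄ a H p] i

/-- The orthonormal frame dual to `coframe`. -/
def frame (a : ℝ) (h H : ℝ × ℝ → ℝ) (i : Fin 4) (p : E4) : E4 :=
  ![(Real.cos (a * p 2) * h (xy p))⁻¹ • (e 0 + (Real.sin (2 * a * p 3) * H (xy p)) • e 2
      + (l₂ a H (xy p) + Real.cos (2 * a * p 2) * (Real.sin (2 * a * p 2))⁻¹
        * (Real.cos (2 * a * p 3) * H (xy p))) • e 3),
    (Real.cos (a * p 2) * h (xy p))⁻¹ • (e 1 + (Real.cos (2 * a * p 3) * H (xy p)) • e 2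
      + (n₂ a H (xy p) - Real.cos (2 * a * p 2) * (Real.sin (2 * a * p 2))⁻¹
        * (Real.sin (2 * a * p 3) * H (xy p))) • e 3),
    (Real.sin (2 * a * p 2))⁻¹ • e 3, e 2] i

/-- The connection forms `ωⁱⱼ` of the Levi-Civita connection in the frame `frame`. -/
def conn (a : ℝ) (h H : ℝ × ℝ → ℝ) (i j : Fin 4) (p : E4) : E4 →L[ℝ] ℝ :=
  !![0, conn₁₂ a h H p, (a * Real.tan (a * p 2)) • θ₂ a h p, -((a * Real.tan (a * p 2)) • θ₁ a h p);
    -conn₁₂ a h H p, 0, -((a * Real.tan (a * p 2)) • θ₁ a h p),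
      -((a * Real.tan (a * p 2)) • θ₂ a h p);
    -((a * Real.tan (a * p 2)) • θ₂ a h p), (a * Real.tan (a * p 2)) • θ₁ a h p, 0,
      (2 * a) • θHat a H p;
    (a * Real.tan (a * p 2)) • θ₁ a h p, (a * Real.tan (a * p 2)) • θ₂ a h p,
      -((2 * a) • θHat a H p), 0] i j

end

namespace IsAdmissible

variable {a : ℝ} {U : Set (ℝ × ℝ)} {h H : ℝ × ℝ → ℝ} {p : E4}

lemma smooth_l₂ (hA : IsAdmissible a U h H) : ContDiffOn ℝ ∞ (l₂ a H) U :=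
  contDiffOn_const.mul (smooth_pdy hA.isOpen (smooth_lnf hA.smooth_H hA.H_pos))

lemma smooth_n₂ (hA : IsAdmissible a U h H) : ContDiffOn ℝ ∞ (n₂ a H) U :=
  contDiffOn_const.mul (smooth_pdx hA.isOpen (smooth_lnf hA.smooth_H hA.H_pos))

lemma isOpen_domain (hA : IsAdmissible a U h H) : IsOpen (domain a U) :=
  KaehlerSurface.isOpen_domain hA.isOpen

lemma cos_ne_zero (hA : IsAdmissible a U h H) (hp : p ∈ domain a U) : Real.cos (a * p 2) ≠ 0 :=
  (cos_pos_of_mem_domain hA.ne_zero hp).ne'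

lemma sin_eq (hA : IsAdmissible a U h H) (hp : p ∈ domain a U) :
    Real.sin (a * p 2) = Real.tan (a * p 2) * Real.cos (a * p 2) :=
  (Real.tan_mul_cos (hA.cos_ne_zero hp)).symm

lemma cos_sq_mul (hA : IsAdmissible a U h H) (hp : p ∈ domain a U) :
    Real.cos (a * p 2) ^ 2 * (1 + Real.tan (a * p 2) ^ 2) = 1 := by
  have h1 := Real.sin_sq_add_cos_sq (a * p 2)
  rw [hA.sin_eq hp] at h1
  linarith

/-- All trigonometric functions of z are reduced to tan(az) and cos²(az); the factor cos² combines
with h² dx ∧ dy into θ₁ ∧ θ₂. -/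
lemma sin_two_eq (hA : IsAdmissible a U h H) (hp : p ∈ domain a U) :
    Real.sin (2 * a * p 2) = 2 * Real.tan (a * p 2) * Real.cos (a * p 2) ^ 2 := by
  rw [mul_assoc, Real.sin_two_mul, hA.sin_eq hp]
  ring

lemma cos_two_eq (hA : IsAdmissible a U h H) (hp : p ∈ domain a U) :
    Real.cos (2 * a * p 2) = (1 - Real.tan (a * p 2) ^ 2) * Real.cos (a * p 2) ^ 2 := by
  rw [mul_assoc, Real.cos_two_mul', hA.sin_eq hp]
  ring

lemma sin_two_ne_zero (hA : IsAdmissible a U h H) (hp : p ∈ domain a U) :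
    Real.sin (2 * a * p 2) ≠ 0 := by
  rw [hA.sin_two_eq hp]
  have h1 := tan_ne_zero_of_mem_domain hA.ne_zero hp
  have h2 := hA.cos_ne_zero hp
  positivity

lemma smooth_tan (hA : IsAdmissible a U h H) :
    ContDiffOn ℝ ∞ (fun p : E4 => Real.tan (a * p 2)) (domain a U) := by
  have h1 : (fun p : E4 => Real.tan (a * p 2))
      = fun p => Real.sin (a * p 2) / Real.cos (a * p 2) :=
    funext fun p => Real.tan_eq_sin_div_cos _
  rw [h1]
  exact ContDiffOn.div (by fun_prop) (by fun_prop) fun p hp => hA.cos_ne_zero hp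

lemma smooth_cos_coord (M : Set E4) (b : ℝ) (i : Fin 4) :
    ContDiffOn ℝ ∞ (fun p : E4 => Real.cos (b * p i)) M :=
  ContDiff.contDiffOn (by fun_prop)

lemma smooth_sin_coord (M : Set E4) (b : ℝ) (i : Fin 4) :
    ContDiffOn ℝ ∞ (fun p : E4 => Real.sin (b * p i)) M :=
  ContDiff.contDiffOn (by fun_prop)

lemma smooth_φ (hA : IsAdmissible a U h H) : ContDiffOn ℝ ∞ (φForm a H) (domain a U) := by
  have h1 := smooth_comp_xy (a := a) hA.smooth_H
  exact (((smooth_cos_coord _ _ _).mul h1).smul contDiffOn_const).sub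
    (((smooth_sin_coord _ _ _).mul h1).smul contDiffOn_const)

lemma smooth_ψ (hA : IsAdmissible a U h H) : ContDiffOn ℝ ∞ (ψForm a H) (domain a U) := by
  have h1 := smooth_comp_xy (a := a) hA.smooth_H
  exact (((smooth_sin_coord _ _ _).mul h1).smul contDiffOn_const).add
    (((smooth_cos_coord _ _ _).mul h1).smul contDiffOn_const)

lemma smooth_γ (hA : IsAdmissible a U h H) : ContDiffOn ℝ ∞ (γForm a H) (domain a U) := by
  have h1 := smooth_comp_xy (a := a) hA.smooth_l₂
  have h2 := smooth_comp_xy (a := a) hA.smooth_n₂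
  unfold γForm
  fun_prop

lemma smooth_κ (hA : IsAdmissible a U h H) : ContDiffOn ℝ ∞ (κForm h) (domain a U) := by
  have h0 := smooth_lnf hA.smooth_h hA.h_pos
  have h1 := smooth_comp_xy (a := a) (smooth_pdx hA.isOpen h0)
  have h2 := smooth_comp_xy (a := a) (smooth_pdy hA.isOpen h0)
  unfold κForm
  fun_prop

lemma smooth_θ₁ (hA : IsAdmissible a U h H) : ContDiffOn ℝ ∞ (θ₁ a h) (domain a U) := by
  exact ((smooth_cos_coord _ _ _).mul (smooth_comp_xy hA.smooth_h)).smul contDiffOn_const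

lemma smooth_θ₂ (hA : IsAdmissible a U h H) : ContDiffOn ℝ ∞ (θ₂ a h) (domain a U) := by
  exact ((smooth_cos_coord _ _ _).mul (smooth_comp_xy hA.smooth_h)).smul contDiffOn_const

lemma smooth_θ₃ (hA : IsAdmissible a U h H) : ContDiffOn ℝ ∞ (θ₃ a H) (domain a U) := by
  have h1 := hA.smooth_φ
  have h2 := hA.smooth_γ
  rw [θ₃_eq]
  fun_prop

lemma smooth_θ₄ (hA : IsAdmissible a U h H) : ContDiffOn ℝ ∞ (θ₄ a H) (domain a U) := by
  have h1 := hA.smooth_ψ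
  rw [θ₄_eq]
  fun_prop

lemma smooth_θHat (hA : IsAdmissible a U h H) : ContDiffOn ℝ ∞ (θHat a H) (domain a U) := by
  have h1 := hA.smooth_φ
  have h2 := hA.smooth_γ
  unfold θHat
  fun_prop

lemma smooth_conn₁₂ (hA : IsAdmissible a U h H) : ContDiffOn ℝ ∞ (conn₁₂ a h H) (domain a U) := by
  have h1 := hA.smooth_φ
  have h2 := hA.smooth_θ₃
  have h3 := hA.smooth_κ
  have h4 := hA.smooth_tan
  unfold conn₁₂
  fun_prop

lemma smooth_coframe (hA : IsAdmissible a U h H) (i : Fin 4) :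
    ContDiffOn ℝ ∞ (coframe a h H i) (domain a U) := by
  fin_cases i
  exacts [hA.smooth_θ₁, hA.smooth_θ₂, hA.smooth_θ₃, hA.smooth_θ₄]

lemma smooth_frame (hA : IsAdmissible a U h H) (i : Fin 4) :
    ContDiffOn ℝ ∞ (frame a h H i) (domain a U) := by
  have h1 := smooth_comp_xy (a := a) hA.smooth_h
  have h2 := smooth_comp_xy (a := a) hA.smooth_H
  have h3 := smooth_comp_xy (a := a) hA.smooth_l₂
  have h4 := smooth_comp_xy (a := a) hA.smooth_n₂
  have h5 : ContDiffOn ℝ ∞ (fun p : E4 => (Real.cos (a * p 2) * h (xy p))⁻¹) (domain a U) :=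
    ((smooth_cos_coord _ _ _).mul h1).inv fun p hp =>
      mul_ne_zero (hA.cos_ne_zero hp) (hA.h_pos _ hp.1).ne'
  have h6 : ContDiffOn ℝ ∞ (fun p : E4 => (Real.sin (2 * a * p 2))⁻¹) (domain a U) :=
    ContDiffOn.inv (by fun_prop) fun p hp => hA.sin_two_ne_zero hp
  have hcos := smooth_cos_coord (domain a U)
  have hsin := smooth_sin_coord (domain a U)
  have hc := fun v : E4 => contDiffOn_const (𝕜 := ℝ) (n := ∞) (s := domain a U) (c := v)
  fin_cases i
  · exact h5.smul (((hc (e 0)).add (((hsin (2 * a) 3).mul h2).smul (hc (e 2)))).add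
      ((h3.add (((hcos (2 * a) 2).mul h6).mul ((hcos (2 * a) 3).mul h2))).smul (hc (e 3))))
  · exact h5.smul (((hc (e 1)).add (((hcos (2 * a) 3).mul h2).smul (hc (e 2)))).add
      ((h4.sub (((hcos (2 * a) 2).mul h6).mul ((hsin (2 * a) 3).mul h2))).smul (hc (e 3))))
  · exact h6.smul (hc (e 3))
  · exact hc (e 2)

lemma smooth_conn (hA : IsAdmissible a U h H) (i j : Fin 4) :
    ContDiffOn ℝ ∞ (conn a h H i j) (domain a U) := by
  have h1 := hA.smooth_θ₁
  have h2 := hA.smooth_θ₂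
  have h3 := hA.smooth_conn₁₂
  have h4 := hA.smooth_tan
  have h5 := hA.smooth_θHat
  unfold conn
  fin_cases i <;> fin_cases j <;> simp <;> fun_prop

lemma coframe_frame (hA : IsAdmissible a U h H) (hp : p ∈ domain a U) (i j : Fin 4) :
    coframe a h H i p (frame a h H j p) = if i = j then 1 else 0 := by
  have h1 := hA.cos_ne_zero hp
  have h2 := (hA.h_pos _ hp.1).ne'
  have h3 := hA.sin_two_ne_zero hp
  fin_cases i <;> fin_cases j <;>
    simp [coframe, frame, θ₁, θ₂, θ₃, θ₄, e] <;> field_simp <;> ring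

lemma conn_skew (i j : Fin 4) (p X : E4) : conn a h H i j p X = -conn a h H j i p X := by
  fin_cases i <;> fin_cases j <;> simp [conn]

lemma metric_eq (p X Y : E4) :
    metric a h H p X Y = ∑ i, coframe a h H i p X * coframe a h H i p Y := by
  simp [metric, gSigma, tensor, coframe, Fin.sum_univ_four, θ₁, θ₂]
  ring

lemma smooth_tensor {M : Set E4} {α β : E4 → E4 →L[ℝ] ℝ} (hα : ContDiffOn ℝ ∞ α M)
    (hβ : ContDiffOn ℝ ∞ β M) : ContDiffOn ℝ ∞ (fun p => tensor (α p) (β p)) M :=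
  hα.smulRight hβ

lemma smooth_metric (hA : IsAdmissible a U h H) :
    ContDiffOn ℝ ∞ (metric a h H) (domain a U) := by
  have h1 : metric a h H = fun p => ∑ i, tensor (coframe a h H i p) (coframe a h H i p) := by
    ext p X Y
    simp [metric_eq, tensor]
  rw [h1]
  exact ContDiffOn.sum fun i _ => smooth_tensor (hA.smooth_coframe i) (hA.smooth_coframe i)

end IsAdmissible
/-! ### Structure equations -/

namespace IsAdmissible

variable {a : ℝ} {U : Set (ℝ × ℝ)} {h H : ℝ × ℝ → ℝ} {p : E4}

lemma fderiv_H (hA : IsAdmissible a U h H) (hp : p ∈ domain a U) (X : E4) :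
    fderiv ℝ (fun q => H (xy q)) p X
      = 2 * a * H (xy p) * (n₂ a H (xy p) * X 0 - l₂ a H (xy p) * X 1) := by
  have hd := differentiableAt_of_contDiffOn_base hA.isOpen hA.smooth_H hp.1
  have ha := hA.ne_zero
  rw [fderiv_comp_xy hd, pdx_eq_mul_pdx_lnf hd (hA.H_pos _ hp.1),
    pdy_eq_mul_pdy_lnf hd (hA.H_pos _ hp.1), n₂, l₂]
  field_simp
  ring

lemma fderiv_h (hA : IsAdmissible a U h H) (hp : p ∈ domain a U) (X : E4) :
    fderiv ℝ (fun q => h (xy q)) p X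
      = h (xy p) * (pdx (lnf h) (xy p) * X 0 + pdy (lnf h) (xy p) * X 1) := by
  have hd := differentiableAt_of_contDiffOn_base hA.isOpen hA.smooth_h hp.1
  rw [fderiv_comp_xy hd, pdx_eq_mul_pdx_lnf hd (hA.h_pos _ hp.1),
    pdy_eq_mul_pdy_lnf hd (hA.h_pos _ hp.1)]
  ring

lemma differentiableAt_of_smooth {F : Type*} [NormedAddCommGroup F] [NormedSpace ℝ F]
    (hA : IsAdmissible a U h H) (hp : p ∈ domain a U) {α : E4 → F}
    (hα : ContDiffOn ℝ ∞ α (domain a U)) : DifferentiableAt ℝ α p :=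
  differentiableAt_of_contDiffOn hA.isOpen_domain hα hp

lemma fderiv_cos_mul_H (hA : IsAdmissible a U h H) (hp : p ∈ domain a U) (X : E4) :
    fderiv ℝ (fun q : E4 => Real.cos (2 * a * q 3) * H (xy q)) p X
      = 2 * a * H (xy p) * (Real.cos (2 * a * p 3) * (n₂ a H (xy p) * X 0 - l₂ a H (xy p) * X 1)
        - Real.sin (2 * a * p 3) * X 3) := by
  rw [fderiv_fun_mul (by fun_prop)
    (hA.differentiableAt_of_smooth hp (smooth_comp_xy hA.smooth_H))]
  simp only [_root_.add_apply, _root_.smul_apply, smul_eq_mul, fderiv_cos_coord, hA.fderiv_H hp]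
  ring

lemma fderiv_sin_mul_H (hA : IsAdmissible a U h H) (hp : p ∈ domain a U) (X : E4) :
    fderiv ℝ (fun q : E4 => Real.sin (2 * a * q 3) * H (xy q)) p X
      = 2 * a * H (xy p) * (Real.sin (2 * a * p 3) * (n₂ a H (xy p) * X 0 - l₂ a H (xy p) * X 1)
        + Real.cos (2 * a * p 3) * X 3) := by
  rw [fderiv_fun_mul (by fun_prop)
    (hA.differentiableAt_of_smooth hp (smooth_comp_xy hA.smooth_H))]
  simp only [_root_.add_apply, _root_.smul_apply, smul_eq_mul, fderiv_sin_coord, hA.fderiv_H hp]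
  ring

lemma differentiableAt_cos_mul_H (hA : IsAdmissible a U h H) (hp : p ∈ domain a U) :
    DifferentiableAt ℝ (fun q : E4 => Real.cos (2 * a * q 3) * H (xy q)) p :=
  hA.differentiableAt_of_smooth hp ((smooth_cos_coord _ _ _).mul (smooth_comp_xy hA.smooth_H))

lemma differentiableAt_sin_mul_H (hA : IsAdmissible a U h H) (hp : p ∈ domain a U) :
    DifferentiableAt ℝ (fun q : E4 => Real.sin (2 * a * q 3) * H (xy q)) p :=
  hA.differentiableAt_of_smooth hp ((smooth_sin_coord _ _ _).mul (smooth_comp_xy hA.smooth_H))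

/-- Real part of d(φ + iψ) = 2ia γ ∧ (φ + iψ). The functions l₂ and n₂ are chosen so that γ absorbs
d ln H. -/
lemma ext₁_φ (hA : IsAdmissible a U h H) (hp : p ∈ domain a U) (X Y : E4) :
    ext₁ (φForm a H) p X Y = -(2 * a) * wd (γForm a H p) (ψForm a H p) X Y := by
  have h1 := hA.differentiableAt_cos_mul_H hp
  have h2 := hA.differentiableAt_sin_mul_H hp
  unfold φForm
  rw [ext₁_sub (h1.smul_const _) (h2.smul_const _), ext₁_smul_const h1, ext₁_smul_const h2]
  simp only [hA.fderiv_cos_mul_H hp, hA.fderiv_sin_mul_H hp, wd, γForm, ψForm, dx_apply,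
    _root_.add_apply, _root_.sub_apply, _root_.smul_apply, smul_eq_mul]
  ring

lemma ext₁_ψ (hA : IsAdmissible a U h H) (hp : p ∈ domain a U) (X Y : E4) :
    ext₁ (ψForm a H) p X Y = 2 * a * wd (γForm a H p) (φForm a H p) X Y := by
  have h1 := hA.differentiableAt_cos_mul_H hp
  have h2 := hA.differentiableAt_sin_mul_H hp
  unfold ψForm
  rw [ext₁_add (h2.smul_const _) (h1.smul_const _), ext₁_smul_const h1, ext₁_smul_const h2]
  simp only [hA.fderiv_cos_mul_H hp, hA.fderiv_sin_mul_H hp, wd, γForm, φForm, dx_apply,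
    _root_.sub_apply, _root_.smul_apply, smul_eq_mul]
  ring

lemma wd_φ_ψ (X Y : E4) :
    wd (φForm a H p) (ψForm a H p) X Y = H (xy p) ^ 2 * wd (dx 0) (dx 1) X Y := by
  have ht := Real.sin_sq_add_cos_sq (2 * a * p 3)
  simp only [wd, φForm, ψForm, dx_apply,
    _root_.add_apply, _root_.sub_apply, _root_.smul_apply, smul_eq_mul]
  linear_combination H (xy p) ^ 2 * (X 0 * Y 1 - Y 0 * X 1) * ht

lemma ext₁_γ (hA : IsAdmissible a U h H) (hp : p ∈ domain a U) (X Y : E4) :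
    ext₁ (γForm a H) p X Y = 2 * a * wd (φForm a H p) (ψForm a H p) X Y
      - a * h (xy p) ^ 2 * wd (dx 0) (dx 1) X Y := by
  have ha := hA.ne_zero
  have h1 := hA.differentiableAt_of_smooth hp (smooth_comp_xy hA.smooth_l₂)
  have h2 := hA.differentiableAt_of_smooth hp (smooth_comp_xy hA.smooth_n₂)
  have hl := differentiableAt_of_contDiffOn_base hA.isOpen hA.smooth_l₂ hp.1
  have hn := differentiableAt_of_contDiffOn_base hA.isOpen hA.smooth_n₂ hp.1
  have hL := smooth_lnf hA.smooth_H hA.H_pos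
  have hLx := differentiableAt_of_contDiffOn_base hA.isOpen (smooth_pdx hA.isOpen hL) hp.1
  have hLy := differentiableAt_of_contDiffOn_base hA.isOpen (smooth_pdy hA.isOpen hL) hp.1
  have hnx : pdx (n₂ a H) (xy p) = 1 / (2 * a) * pdx (pdx (lnf H)) (xy p) := by
    unfold n₂
    conv_lhs => rw [pdx]
    rw [fderiv_const_mul hLx]
    rfl
  have hly : pdy (l₂ a H) (xy p) = -(1 / (2 * a)) * pdy (pdy (lnf H)) (xy p) := by
    unfold l₂
    conv_lhs => rw [pdy]
    rw [fderiv_const_mul hLy]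
    rfl
  -- This is the only use of the equation for Δ ln H.
  have hΔ : pdx (n₂ a H) (xy p) - pdy (l₂ a H) (xy p) = a * h (xy p) ^ 2 - 2 * a * H (xy p) ^ 2 := by
    rw [hnx, hly]
    have := hA.laplace _ hp.1
    field_simp
    linear_combination this
  unfold γForm
  rw [ext₁_sub ((differentiableAt_const _).fun_sub (h1.smul_const _)) (h2.smul_const _),
    ext₁_sub (differentiableAt_const _) (h1.smul_const _), ext₁_smul_const h1, ext₁_smul_const h2,
    ext₁_const, fderiv_comp_xy hl, fderiv_comp_xy hl, fderiv_comp_xy hn, fderiv_comp_xy hn,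
    wd_φ_ψ]
  simp only [wd, dx_apply]
  linear_combination -(X 0 * Y 1 - Y 0 * X 1) * hΔ

lemma ext₁_κ (hA : IsAdmissible a U h H) (hp : p ∈ domain a U) (X Y : E4) :
    ext₁ (κForm h) p X Y = (pdx (pdx (lnf h)) (xy p) + pdy (pdy (lnf h)) (xy p))
      * wd (dx 0) (dx 1) X Y := by
  have hL := smooth_lnf hA.smooth_h hA.h_pos
  have hLx := smooth_pdx hA.isOpen hL
  have hLy := smooth_pdy hA.isOpen hL
  have h1 := hA.differentiableAt_of_smooth hp (smooth_comp_xy hLx)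
  have h2 := hA.differentiableAt_of_smooth hp (smooth_comp_xy hLy)
  have h3 := differentiableAt_of_contDiffOn_base hA.isOpen hLx hp.1
  have h4 := differentiableAt_of_contDiffOn_base hA.isOpen hLy hp.1
  unfold κForm
  rw [ext₁_sub (h1.smul_const _) (h2.smul_const _), ext₁_smul_const h1, ext₁_smul_const h2,
    fderiv_comp_xy h3, fderiv_comp_xy h3, fderiv_comp_xy h4, fderiv_comp_xy h4]
  simp only [wd, dx_apply]
  ring

lemma ext₁_θ₃ (hA : IsAdmissible a U h H) (hp : p ∈ domain a U) (X Y : E4) :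
    ext₁ (θ₃ a H) p X Y = 2 * a * wd (θ₄ a H p) (θHat a H p) X Y
      - 2 * a * Real.tan (a * p 2) * wd (θ₁ a h p) (θ₂ a h p) X Y := by
  have hγ := hA.differentiableAt_of_smooth hp hA.smooth_γ
  have hφ := hA.differentiableAt_of_smooth hp hA.smooth_φ
  have hs := hA.sin_two_eq hp
  have hsd : DifferentiableAt ℝ (fun q : E4 => Real.sin (2 * a * q 2)) p := by fun_prop
  have hcd : DifferentiableAt ℝ (fun q : E4 => Real.cos (2 * a * q 2)) p := by fun_prop
  rw [θ₃_eq, ext₁_sub (hsd.fun_smul hγ) (hcd.fun_smul hφ), ext₁_smul hsd hγ, ext₁_smul hcd hφ,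
    hA.ext₁_γ hp, hA.ext₁_φ hp]
  simp only [fderiv_sin_coord, fderiv_cos_coord, θ₄_eq, θHat, θ₁, θ₂, wd, dx_apply,
    _root_.add_apply, _root_.sub_apply, _root_.smul_apply, smul_eq_mul]
  linear_combination -a * h (xy p) ^ 2 * (X 0 * Y 1 - Y 0 * X 1) * hs

/-- Here dθ₄ = -dψ = -2a γ ∧ φ, and the rotation by 2az preserves the two-form γ ∧ φ. -/
lemma ext₁_θ₄ (hA : IsAdmissible a U h H) (hp : p ∈ domain a U) (X Y : E4) :
    ext₁ (θ₄ a H) p X Y = -(2 * a) * wd (θ₃ a H p) (θHat a H p) X Y := by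
  have hψ := hA.differentiableAt_of_smooth hp hA.smooth_ψ
  have ht := Real.sin_sq_add_cos_sq (2 * a * p 2)
  rw [θ₄_eq, ext₁_sub (differentiableAt_const _) hψ, ext₁_const, hA.ext₁_ψ hp]
  simp only [θ₃_eq, θHat, wd,
    _root_.add_apply, _root_.sub_apply, _root_.smul_apply, smul_eq_mul]
  linear_combination 2 * a * (γForm a H p X * φForm a H p Y - γForm a H p Y * φForm a H p X) * ht

lemma ext₁_θHat (hA : IsAdmissible a U h H) (hp : p ∈ domain a U) (X Y : E4) :
    ext₁ (θHat a H) p X Y = 2 * a * wd (θ₃ a H p) (θ₄ a H p) X Y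
      - a * Real.cos (2 * a * p 2) * h (xy p) ^ 2 * wd (dx 0) (dx 1) X Y := by
  have hγ := hA.differentiableAt_of_smooth hp hA.smooth_γ
  have hφ := hA.differentiableAt_of_smooth hp hA.smooth_φ
  have hsd : DifferentiableAt ℝ (fun q : E4 => Real.sin (2 * a * q 2)) p := by fun_prop
  have hcd : DifferentiableAt ℝ (fun q : E4 => Real.cos (2 * a * q 2)) p := by fun_prop
  unfold θHat
  rw [ext₁_add (hcd.fun_smul hγ) (hsd.fun_smul hφ), ext₁_smul hsd hφ, ext₁_smul hcd hγ,
    hA.ext₁_γ hp, hA.ext₁_φ hp]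
  simp only [fderiv_sin_coord, fderiv_cos_coord, θ₄_eq, θ₃_eq, wd, dx_apply,
    _root_.sub_apply, _root_.smul_apply, smul_eq_mul]
  ring

lemma fderiv_cos_mul_h (hA : IsAdmissible a U h H) (hp : p ∈ domain a U) (X : E4) :
    fderiv ℝ (fun q : E4 => Real.cos (a * q 2) * h (xy q)) p X
      = Real.cos (a * p 2) * h (xy p) * (pdx (lnf h) (xy p) * X 0 + pdy (lnf h) (xy p) * X 1
        - a * Real.tan (a * p 2) * X 2) := by
  rw [fderiv_fun_mul (by fun_prop)
    (hA.differentiableAt_of_smooth hp (smooth_comp_xy hA.smooth_h))]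
  simp only [_root_.add_apply, _root_.smul_apply, smul_eq_mul, fderiv_cos_coord, hA.fderiv_h hp,
    hA.sin_eq hp]
  ring

lemma ext₁_θ₁ (hA : IsAdmissible a U h H) (hp : p ∈ domain a U) (X Y : E4) :
    ext₁ (θ₁ a h) p X Y = -(a * Real.tan (a * p 2)) * wd (θ₄ a H p) (θ₁ a h p) X Y
      + a * Real.tan (a * p 2) * wd (φForm a H p) (θ₂ a h p) X Y
      + wd (κForm h p) (θ₂ a h p) X Y := by
  have h1 := hA.differentiableAt_of_smooth hp
    ((smooth_cos_coord _ a 2).mul (smooth_comp_xy hA.smooth_h))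
  unfold θ₁
  rw [ext₁_smul_const h1, hA.fderiv_cos_mul_h hp, hA.fderiv_cos_mul_h hp]
  simp only [θ₄, φForm, κForm, θ₂, wd, dx_apply, _root_.sub_apply, _root_.smul_apply, smul_eq_mul]
  ring

lemma ext₁_θ₂ (hA : IsAdmissible a U h H) (hp : p ∈ domain a U) (X Y : E4) :
    ext₁ (θ₂ a h) p X Y = -(a * Real.tan (a * p 2)) * wd (θ₄ a H p) (θ₂ a h p) X Y
      - a * Real.tan (a * p 2) * wd (φForm a H p) (θ₁ a h p) X Y
      - wd (κForm h p) (θ₁ a h p) X Y := by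
  have h1 := hA.differentiableAt_of_smooth hp
    ((smooth_cos_coord _ a 2).mul (smooth_comp_xy hA.smooth_h))
  unfold θ₂
  rw [ext₁_smul_const h1, hA.fderiv_cos_mul_h hp, hA.fderiv_cos_mul_h hp]
  simp only [θ₄, φForm, κForm, θ₁, wd, dx_apply, _root_.sub_apply, _root_.smul_apply, smul_eq_mul]
  ring

lemma torsion (hA : IsAdmissible a U h H) (hp : p ∈ domain a U) (i : Fin 4) (X Y : E4) :
    ext₁ (coframe a h H i) p X Y = ∑ j, (conn a h H i j p Y * coframe a h H j p X
      - conn a h H i j p X * coframe a h H j p Y) := by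
  fin_cases i
  · refine (hA.ext₁_θ₁ hp X Y).trans ?_
    simp [Fin.sum_univ_four, conn, coframe, conn₁₂, wd]
    ring
  · refine (hA.ext₁_θ₂ hp X Y).trans ?_
    simp [Fin.sum_univ_four, conn, coframe, conn₁₂, wd]
    ring
  · refine (hA.ext₁_θ₃ hp X Y).trans ?_
    simp [Fin.sum_univ_four, conn, coframe, conn₁₂, wd]
    ring
  · refine (hA.ext₁_θ₄ hp X Y).trans ?_
    simp [Fin.sum_univ_four, conn, coframe, conn₁₂, wd]
    ring

/-- The forms above are a moving frame for the metric. -/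
lemma isMovingFrameOn (hA : IsAdmissible a U h H) :
    IsMovingFrameOn (domain a U) (metric a h H) (coframe a h H) (frame a h H) (conn a h H) where
  isOpen := hA.isOpen_domain
  smooth_coframe := hA.smooth_coframe
  smooth_frame := hA.smooth_frame
  smooth_conn := hA.smooth_conn
  dual _ hp := hA.coframe_frame hp
  metric_eq p _ := metric_eq p
  skew p _ i j := conn_skew i j p
  torsion _ hp := hA.torsion hp

end IsAdmissible
/-! ### Curvature forms -/

/-- The sectional curvature of the horizontal planes. -/
noncomputable def horizontalCurv (a : ℝ) (h H : ℝ × ℝ → ℝ) (p : E4) : ℝ :=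
  (2 * a ^ 2 * H (xy p) ^ 2 - (pdx (pdx (lnf h)) (xy p) + pdy (pdy (lnf h)) (xy p)))
    / (Real.cos (a * p 2) ^ 2 * h (xy p) ^ 2) - 4 * a ^ 2 * Real.tan (a * p 2) ^ 2

lemma curvForm_eq_ext₁ (w : Fin 4 → Fin 4 → E4 → E4 →L[ℝ] ℝ) (i j : Fin 4) (p X Y : E4) :
    curvForm w i j p X Y = ext₁ (w i j) p X Y + ∑ k, wd (w i k p) (w k j p) X Y := rfl

namespace IsAdmissible

variable {a : ℝ} {U : Set (ℝ × ℝ)} {h H : ℝ × ℝ → ℝ} {p : E4}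

lemma differentiableAt_tan (hA : IsAdmissible a U h H) (hp : p ∈ domain a U) :
    DifferentiableAt ℝ (fun q : E4 => a * Real.tan (a * q 2)) p :=
  (hA.differentiableAt_of_smooth hp hA.smooth_tan).const_mul a

lemma ext₁_tan_smul (hA : IsAdmissible a U h H) (hp : p ∈ domain a U) {α : E4 → E4 →L[ℝ] ℝ}
    (hα : DifferentiableAt ℝ α p) (X Y : E4) :
    ext₁ (fun q => (a * Real.tan (a * q 2)) • α q) p X Y
      = a ^ 2 * (1 + Real.tan (a * p 2) ^ 2) * wd (dx 2) (α p) X Y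
        + a * Real.tan (a * p 2) * ext₁ α p X Y := by
  rw [ext₁_smul (hA.differentiableAt_tan hp) hα,
    fderiv_const_mul (hA.differentiableAt_of_smooth hp hA.smooth_tan)]
  simp only [_root_.smul_apply, smul_eq_mul, fderiv_tan_coord (hA.cos_ne_zero hp), wd, dx_apply]
  ring

lemma double_angle_sin (hA : IsAdmissible a U h H) (hp : p ∈ domain a U) :
    Real.tan (a * p 2) ^ 2 * Real.sin (2 * a * p 2)
      + 2 * Real.tan (a * p 2) * Real.cos (2 * a * p 2) = Real.sin (2 * a * p 2) := by
  rw [hA.sin_two_eq hp, hA.cos_two_eq hp]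
  ring

/-- This identity and its two neighbours make the z-dependence disappear from the mixed curvature
forms, leaving the constant a². -/
lemma double_angle_one (hA : IsAdmissible a U h H) (hp : p ∈ domain a U) :
    Real.tan (a * p 2) * Real.sin (2 * a * p 2) + Real.cos (2 * a * p 2) = 1 := by
  rw [hA.sin_two_eq hp, hA.cos_two_eq hp]
  linear_combination hA.cos_sq_mul hp

lemma double_angle_tan (hA : IsAdmissible a U h H) (hp : p ∈ domain a U) :
    Real.tan (a * p 2) * (1 + Real.cos (2 * a * p 2)) = Real.sin (2 * a * p 2) := by
  rw [hA.sin_two_eq hp, hA.cos_two_eq hp]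
  linear_combination -Real.tan (a * p 2) * hA.cos_sq_mul hp

/-- Both φ + iψ and θ₁ + iθ₂ are multiples of dx + i dy, so their wedge product vanishes; this is
its imaginary part, and the next lemma its real part. -/
lemma wd_ψ_θ₁ (X Y : E4) :
    wd (ψForm a H p) (θ₁ a h p) X Y = -wd (φForm a H p) (θ₂ a h p) X Y := by
  simp only [wd, φForm, ψForm, θ₁, θ₂, dx_apply, _root_.add_apply, _root_.sub_apply,
    _root_.smul_apply, smul_eq_mul]
  ring

lemma wd_ψ_θ₂ (X Y : E4) :
    wd (ψForm a H p) (θ₂ a h p) X Y = wd (φForm a H p) (θ₁ a h p) X Y := by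
  simp only [wd, φForm, ψForm, θ₁, θ₂, dx_apply, _root_.add_apply, _root_.sub_apply,
    _root_.smul_apply, smul_eq_mul]
  ring

lemma ext₁_tan_θ₁ (hA : IsAdmissible a U h H) (hp : p ∈ domain a U) (X Y : E4) :
    ext₁ (fun q => (a * Real.tan (a * q 2)) • θ₁ a h q) p X Y
      = a ^ 2 * wd (θ₄ a H p) (θ₁ a h p) X Y + a ^ 2 * wd (θ₃ a H p) (θ₂ a h p) X Y
        + a * Real.tan (a * p 2) * wd (θ₂ a h p) (conn₁₂ a h H p) X Y
        - a * Real.tan (a * p 2) * (2 * a) * wd (θHat a H p) (θ₂ a h p) X Y := by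
  have k1 := hA.double_angle_sin hp
  have k2 := hA.double_angle_one hp
  have k3 := hA.double_angle_tan hp
  have hw := wd_ψ_θ₁ (a := a) (H := H) (h := h) (p := p) X Y
  rw [hA.ext₁_tan_smul hp (hA.differentiableAt_of_smooth hp hA.smooth_θ₁), hA.ext₁_θ₁ hp]
  simp only [wd, conn₁₂, θ₃_eq, θ₄_eq, θHat, dx_apply, _root_.add_apply, _root_.sub_apply,
    _root_.smul_apply, smul_eq_mul] at hw ⊢
  linear_combination a ^ 2 * (1 + Real.tan (a * p 2) ^ 2) * hw
    + a ^ 2 * (γForm a H p X * θ₂ a h p Y - γForm a H p Y * θ₂ a h p X) * k1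
    + a ^ 2 * (φForm a H p X * θ₂ a h p Y - φForm a H p Y * θ₂ a h p X)
      * (k2 - Real.tan (a * p 2) * k3)

lemma ext₁_tan_θ₂ (hA : IsAdmissible a U h H) (hp : p ∈ domain a U) (X Y : E4) :
    ext₁ (fun q => (a * Real.tan (a * q 2)) • θ₂ a h q) p X Y
      = a ^ 2 * wd (θ₄ a H p) (θ₂ a h p) X Y - a ^ 2 * wd (θ₃ a H p) (θ₁ a h p) X Y
        - a * Real.tan (a * p 2) * wd (θ₁ a h p) (conn₁₂ a h H p) X Y
        + a * Real.tan (a * p 2) * (2 * a) * wd (θHat a H p) (θ₁ a h p) X Y := by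
  have k1 := hA.double_angle_sin hp
  have k2 := hA.double_angle_one hp
  have k3 := hA.double_angle_tan hp
  have hw := wd_ψ_θ₂ (a := a) (H := H) (h := h) (p := p) X Y
  rw [hA.ext₁_tan_smul hp (hA.differentiableAt_of_smooth hp hA.smooth_θ₂), hA.ext₁_θ₂ hp]
  simp only [wd, conn₁₂, θ₃_eq, θ₄_eq, θHat, dx_apply, _root_.add_apply, _root_.sub_apply,
    _root_.smul_apply, smul_eq_mul] at hw ⊢
  linear_combination a ^ 2 * (1 + Real.tan (a * p 2) ^ 2) * hw
    - a ^ 2 * (γForm a H p X * θ₁ a h p Y - γForm a H p Y * θ₁ a h p X) * k1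
    - a ^ 2 * (φForm a H p X * θ₁ a h p Y - φForm a H p Y * θ₁ a h p X)
      * (k2 - Real.tan (a * p 2) * k3)

lemma horizontalCurv_mul (hA : IsAdmissible a U h H) (hp : p ∈ domain a U) (X Y : E4) :
    horizontalCurv a h H p * wd (θ₁ a h p) (θ₂ a h p) X Y
      = (2 * a ^ 2 * H (xy p) ^ 2 - (pdx (pdx (lnf h)) (xy p) + pdy (pdy (lnf h)) (xy p)))
          * wd (dx 0) (dx 1) X Y
        - 4 * a ^ 2 * Real.tan (a * p 2) ^ 2 * wd (θ₁ a h p) (θ₂ a h p) X Y := by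
  have h1 := hA.cos_ne_zero hp
  have h2 := (hA.h_pos _ hp.1).ne'
  simp only [wd, horizontalCurv, θ₁, θ₂, dx_apply, _root_.smul_apply, smul_eq_mul]
  field_simp

lemma ext₁_conn₁₂ (hA : IsAdmissible a U h H) (hp : p ∈ domain a U) (X Y : E4) :
    ext₁ (conn₁₂ a h H) p X Y
      = (horizontalCurv a h H p + 2 * a ^ 2 * Real.tan (a * p 2) ^ 2)
          * wd (θ₁ a h p) (θ₂ a h p) X Y
        - 2 * a ^ 2 * wd (θ₃ a H p) (θ₄ a H p) X Y := by
  have k1 := hA.double_angle_sin hp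
  have k2 := hA.double_angle_one hp
  have k3 := hA.double_angle_tan hp
  have hw := wd_φ_ψ (a := a) (H := H) (p := p) X Y
  have hφ := hA.differentiableAt_of_smooth hp hA.smooth_φ
  have hθ := hA.differentiableAt_of_smooth hp hA.smooth_θ₃
  have hκ := hA.differentiableAt_of_smooth hp hA.smooth_κ
  unfold conn₁₂
  rw [ext₁_sub ((hA.differentiableAt_tan hp).fun_smul (hθ.fun_sub hφ)) hκ,
    hA.ext₁_tan_smul hp (hθ.fun_sub hφ), ext₁_sub hθ hφ, hA.ext₁_κ hp, hA.ext₁_θ₃ hp,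
    hA.ext₁_φ hp, add_mul (horizontalCurv a h H p), hA.horizontalCurv_mul hp]
  -- θ₁ ∧ θ₂ is kept atomic while the other wedge products are expanded in γ, φ, ψ and dz.
  generalize wd (θ₁ a h p) (θ₂ a h p) X Y = D
  simp only [wd, θ₃_eq, θ₄_eq, θHat, dx_apply, _root_.add_apply, _root_.sub_apply,
    _root_.smul_apply, smul_eq_mul] at hw ⊢
  linear_combination 2 * a ^ 2 * hw
    + a ^ 2 * (X 2 * γForm a H p Y - Y 2 * γForm a H p X) * k1
    + a ^ 2 * (X 2 * φForm a H p Y - Y 2 * φForm a H p X) * (k2 - Real.tan (a * p 2) * k3)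
    - 2 * a ^ 2 * (ψForm a H p X * γForm a H p Y - ψForm a H p Y * γForm a H p X) * k3
    - 2 * a ^ 2 * (ψForm a H p X * φForm a H p Y - ψForm a H p Y * φForm a H p X) * k2

/-- The curvature forms of the metric. -/
lemma curvForm_eq (hA : IsAdmissible a U h H) (hp : p ∈ domain a U) (i j : Fin 4) (X Y : E4) :
    curvForm (conn a h H) i j p X Y =
      let F₁₂ := horizontalCurv a h H p * wd (θ₁ a h p) (θ₂ a h p) X Y
        - 2 * a ^ 2 * wd (θ₃ a H p) (θ₄ a H p) X Y
      let F₃₄ := 4 * a ^ 2 * wd (θ₃ a H p) (θ₄ a H p) X Y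
        - 2 * a ^ 2 * wd (θ₁ a h p) (θ₂ a h p) X Y
      let F₄₁ := a ^ 2 * (wd (θ₄ a H p) (θ₁ a h p) X Y + wd (θ₃ a H p) (θ₂ a h p) X Y)
      let F₃₁ := a ^ 2 * (wd (θ₃ a H p) (θ₁ a h p) X Y - wd (θ₄ a H p) (θ₂ a h p) X Y)
      !![0, F₁₂, -F₃₁, -F₄₁; -F₁₂, 0, -F₄₁, F₃₁; F₃₁, F₄₁, 0, F₃₄; F₄₁, -F₃₁, -F₃₄, 0] i j := by
  have e0 : ext₁ (fun _ => (0 : E4 →L[ℝ] ℝ)) p X Y = 0 := ext₁_const 0 X Y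
  have e1 := hA.ext₁_tan_θ₁ hp X Y
  have e2 := hA.ext₁_tan_θ₂ hp X Y
  have e3 := hA.ext₁_conn₁₂ hp X Y
  have e4 : ext₁ (fun q => (2 * a) • θHat a H q) p X Y
      = 4 * a ^ 2 * wd (θ₃ a H p) (θ₄ a H p) X Y
        - 2 * a ^ 2 * (1 - Real.tan (a * p 2) ^ 2) * wd (θ₁ a h p) (θ₂ a h p) X Y := by
    rw [ext₁_smul (differentiableAt_const _) (hA.differentiableAt_of_smooth hp hA.smooth_θHat),
      hA.ext₁_θHat hp, hA.cos_two_eq hp]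
    simp [wd, θ₁, θ₂]
    ring
  -- Up to sign, the connection matrix has only four distinct nonzero entries to differentiate.
  have hext : ∀ i j, ext₁ (conn a h H i j) p X Y =
      let A₁ := ext₁ (fun q => (a * Real.tan (a * q 2)) • θ₁ a h q) p X Y
      let A₂ := ext₁ (fun q => (a * Real.tan (a * q 2)) • θ₂ a h q) p X Y
      let B := ext₁ (conn₁₂ a h H) p X Y
      let C := ext₁ (fun q => (2 * a) • θHat a H q) p X Y
      !![0, B, A₂, -A₁; -B, 0, -A₁, -A₂; -A₂, A₁, 0, C; A₁, A₂, -C, 0] i j := by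
    intro i j
    fin_cases i <;> fin_cases j
    exacts [e0, rfl, rfl, ext₁_neg X Y, ext₁_neg X Y, e0, ext₁_neg X Y, ext₁_neg X Y,
      ext₁_neg X Y, rfl, e0, rfl, rfl, rfl, ext₁_neg X Y, e0]
  rw [curvForm_eq_ext₁, hext, e1, e2, e3, e4]
  fin_cases i <;> fin_cases j <;> simp [conn, Fin.sum_univ_four, wd] <;> ring

end IsAdmissible
/-! ### Wedge products of covectors with forms -/

lemma wedge_apply_two (α β : E4 →L[ℝ] ℝ) (X Y : E4) : wedge₁ α β ![X, Y] = wd α β X Y := by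
  simp [wedge₁, wedge, ContinuousAlternatingMap.alternatizeUncurryFin_apply, Fin.sum_univ_two, wd,
    Fin.removeNth]
  ring

lemma wedge_apply_three (η : E4 →L[ℝ] ℝ) (w : E4 [⋀^Fin 2]→L[ℝ] ℝ) (X Y Z : E4) :
    wedge η w ![X, Y, Z] = η X * w ![Y, Z] - η Y * w ![X, Z] + η Z * w ![X, Y] := by
  have hv0 : Fin.removeNth 0 ![X, Y, Z] = ![Y, Z] := by ext i; fin_cases i <;> rfl
  have hv1 : Fin.removeNth 1 ![X, Y, Z] = ![X, Z] := by ext i; fin_cases i <;> rfl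
  have hv2 : Fin.removeNth 2 ![X, Y, Z] = ![X, Y] := by ext i; fin_cases i <;> rfl
  rw [wedge, ContinuousAlternatingMap.alternatizeUncurryFin_apply]
  refine (Fin.sum_univ_three _).trans ?_
  rw [hv0, hv1, hv2]
  simp
  ring

lemma form_ext_two {w₁ w₂ : E4 [⋀^Fin 2]→L[ℝ] ℝ} (h : ∀ X Y, w₁ ![X, Y] = w₂ ![X, Y]) :
    w₁ = w₂ := by
  ext v
  have hv : v = ![v 0, v 1] := by ext i; fin_cases i <;> rfl
  rw [hv, h]

lemma form_ext_three {w₁ w₂ : E4 [⋀^Fin 3]→L[ℝ] ℝ}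
    (h : ∀ X Y Z, w₁ ![X, Y, Z] = w₂ ![X, Y, Z]) : w₁ = w₂ := by
  ext v
  have hv : v = ![v 0, v 1, v 2] := by ext i; fin_cases i <;> rfl
  rw [hv, h]

lemma smooth_wedge₁ {M : Set E4} {α β : E4 → E4 →L[ℝ] ℝ} (hα : ContDiffOn ℝ ∞ α M)
    (hβ : ContDiffOn ℝ ∞ β M) : ContDiffOn ℝ ∞ (fun p => wedge₁ (α p) (β p)) M := by
  have h1 : ContDiffOn ℝ ∞
      (fun p => ContinuousAlternatingMap.ofSubsingleton ℝ E4 ℝ (0 : Fin 1) (β p)) M :=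
    (ContinuousAlternatingMap.ofSubsingletonLIE (𝕜 := ℝ) (E := E4) (F := ℝ)
      (0 : Fin 1)).contDiff.comp_contDiffOn hβ
  exact (ContinuousAlternatingMap.alternatizeUncurryFinCLM ℝ E4 ℝ).contDiff.comp_contDiffOn
    (hα.smulRight h1)

lemma extDeriv_smul_form {f : E4 → ℝ} {Ω : E4 → E4 [⋀^Fin 2]→L[ℝ] ℝ} {p : E4}
    (hf : DifferentiableAt ℝ f p) (hΩ : DifferentiableAt ℝ Ω p) :
    extDeriv (fun q => f q • Ω q) p = f p • extDeriv Ω p + wedge (fderiv ℝ f p) (Ω p) := by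
  rw [extDeriv, fderiv_fun_smul hf hΩ, ContinuousAlternatingMap.alternatizeUncurryFin_add,
    ContinuousAlternatingMap.alternatizeUncurryFin_smul]
  rfl

/-! ### The complex structures J̄ and J, their Kähler forms and the Lee form. -/

/-- The matrix of `J̄` in the frame: `J̄E₁ = E₂`, `J̄E₄ = E₃`. -/
def jBar : Matrix (Fin 4) (Fin 4) ℝ := !![0, -1, 0, 0; 1, 0, 0, 0; 0, 0, 0, 1; 0, 0, -1, 0]

/-- The matrix of `J` in the frame: `JE₁ = E₂`, `JE₃ = E₄`. -/
def jOpp : Matrix (Fin 4) (Fin 4) ℝ := !![0, -1, 0, 0; 1, 0, 0, 0; 0, 0, 0, -1; 0, 0, 1, 0]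

lemma jBar_sq : jBar * jBar = -1 := by
  ext i j
  fin_cases i <;> fin_cases j <;> simp [jBar, Matrix.mul_apply, Fin.sum_univ_four]

lemma jOpp_sq : jOpp * jOpp = -1 := by
  ext i j
  fin_cases i <;> fin_cases j <;> simp [jOpp, Matrix.mul_apply, Fin.sum_univ_four]

lemma jBar_transpose : jBar.transpose = -jBar := by
  ext i j
  fin_cases i <;> fin_cases j <;> simp [jBar]

lemma jOpp_transpose : jOpp.transpose = -jOpp := by
  ext i j
  fin_cases i <;> fin_cases j <;> simp [jOpp]

/-- J̄ is parallel, from which both its integrability and dΩ̄ = 0 follow. -/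
lemma connComm_jBar (a : ℝ) (h H : ℝ × ℝ → ℝ) (p V : E4) (i j : Fin 4) :
    connComm jBar (conn a h H) p V i j = 0 := by
  fin_cases i <;> fin_cases j <;> simp [connComm, jBar, conn, Fin.sum_univ_four]

/-- J and J̄ agree on the horizontal plane and are opposite on the vertical one, so only the mixed
blocks of the connection fail to commute with J. -/
lemma connComm_jOpp (a : ℝ) (h H : ℝ × ℝ → ℝ) (p V : E4) (i j : Fin 4) :
    connComm jOpp (conn a h H) p V i j =
      2 * (a * Real.tan (a * p 2)) * !![0, 0, θ₁ a h p V, θ₂ a h p V; 0, 0, θ₂ a h p V, -θ₁ a h p V;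
        -θ₁ a h p V, -θ₂ a h p V, 0, 0; -θ₂ a h p V, θ₁ a h p V, 0, 0] i j := by
  fin_cases i <;> fin_cases j <;> simp [connComm, jOpp, conn, Fin.sum_univ_four] <;> ring

namespace IsAdmissible

variable {a : ℝ} {U : Set (ℝ × ℝ)} {h H : ℝ × ℝ → ℝ} {p : E4}

lemma ΩBar_apply (p X Y : E4) : ΩBar a h H p ![X, Y]
    = ∑ i, (∑ j, jBar i j * coframe a h H j p X) * coframe a h H i p Y := by
  simp [ΩBar, areaSigma, wedge_apply_two, wd, Fin.sum_univ_four, jBar, coframe, θ₁, θ₂]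
  ring

lemma Ω_apply (p X Y : E4) : Ω a h H p ![X, Y]
    = ∑ i, (∑ j, jOpp i j * coframe a h H j p X) * coframe a h H i p Y := by
  simp [Ω, areaSigma, wedge_apply_two, wd, Fin.sum_univ_four, jOpp, coframe, θ₁, θ₂]
  ring

lemma smooth_horizontal_form (hA : IsAdmissible a U h H) :
    ContDiffOn ℝ ∞ (fun p => Real.cos (a * p 2) ^ 2 • areaSigma h p) (domain a U) := by
  have h1 : (fun p => Real.cos (a * p 2) ^ 2 • areaSigma h p)
      = fun p => wedge₁ (θ₁ a h p) (θ₂ a h p) := by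
    funext p
    refine form_ext_two fun X Y => ?_
    simp [areaSigma, wedge_apply_two, wd, θ₁, θ₂]
    ring
  rw [h1]
  exact smooth_wedge₁ hA.smooth_θ₁ hA.smooth_θ₂

lemma differentiableAt_ΩBar (hA : IsAdmissible a U h H) (hp : p ∈ domain a U) :
    DifferentiableAt ℝ (ΩBar a h H) p :=
  hA.differentiableAt_of_smooth hp
    (hA.smooth_horizontal_form.add (smooth_wedge₁ hA.smooth_θ₄ hA.smooth_θ₃))

lemma differentiableAt_Ω (hA : IsAdmissible a U h H) (hp : p ∈ domain a U) :
    DifferentiableAt ℝ (Ω a h H) p :=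
  hA.differentiableAt_of_smooth hp
    (hA.smooth_horizontal_form.add (smooth_wedge₁ hA.smooth_θ₃ hA.smooth_θ₄))

lemma extDeriv_ΩBar (hA : IsAdmissible a U h H) (hp : p ∈ domain a U) :
    extDeriv (ΩBar a h H) p = 0 := by
  refine form_ext_three fun X Y Z => ?_
  rw [hA.isMovingFrameOn.extDeriv_apply_of_frame jBar_transpose hp (hA.differentiableAt_ΩBar hp)
    fun p _ => ΩBar_apply p]
  simp [connComm_jBar]

lemma extDeriv_Ω (hA : IsAdmissible a U h H) (hp : p ∈ domain a U) :
    extDeriv (Ω a h H) p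
      = (2 : ℝ) • wedge (-(2 * a * Real.tan (a * p 2)) • θ₄ a H p) (Ω a h H p) := by
  refine form_ext_three fun X Y Z => ?_
  rw [hA.isMovingFrameOn.extDeriv_apply_of_frame jOpp_transpose hp (hA.differentiableAt_Ω hp)
    fun p _ => Ω_apply p, ContinuousAlternatingMap.smul_apply, wedge_apply_three]
  simp only [Ω_apply, connComm_jOpp, Fin.sum_univ_four]
  simp [jOpp, coframe]
  ring

/-- Ω is nondegenerate in dimension four: evaluating η ∧ Ω on Eᵢ and the J-invariant frame plane not
containing Eᵢ returns η(Eᵢ). -/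
lemma wedge_Ω_injective (hA : IsAdmissible a U h H) (hp : p ∈ domain a U) {η₁ η₂ : E4 →L[ℝ] ℝ}
    (hη : wedge η₁ (Ω a h H p) = wedge η₂ (Ω a h H p)) : η₁ = η₂ := by
  have hE := hA.coframe_frame hp
  have hw := fun X Y Z => congrArg (fun w : E4 [⋀^Fin 3]→L[ℝ] ℝ => w ![X, Y, Z]) hη
  simp only [wedge_apply_three, Ω_apply] at hw
  have hΩ : ∀ i j, ∑ k, (∑ l, jOpp k l * coframe a h H l p (frame a h H i p))
      * coframe a h H k p (frame a h H j p) = jOpp j i := by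
    intro i j
    simp [hE]
  have h0 := hw (frame a h H 0 p) (frame a h H 2 p) (frame a h H 3 p)
  have h1 := hw (frame a h H 1 p) (frame a h H 2 p) (frame a h H 3 p)
  have h2 := hw (frame a h H 2 p) (frame a h H 0 p) (frame a h H 1 p)
  have h3 := hw (frame a h H 3 p) (frame a h H 0 p) (frame a h H 1 p)
  simp only [hΩ] at h0 h1 h2 h3
  simp [jOpp] at h0 h1 h2 h3
  ext X
  rw [hA.isMovingFrameOn.expand hp X]
  simp [Fin.sum_univ_four, h0, h1, h2, h3]

lemma isLeeFormOn (hA : IsAdmissible a U h H) : IsLeeFormOn (domain a U) (Ω a h H)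
    (fun p => -(2 * a * Real.tan (a * p 2)) • θ₄ a H p) := by
  intro p hp η
  rw [hA.extDeriv_Ω hp]
  constructor
  · intro hη
    exact (hA.wedge_Ω_injective hp (smul_right_injective _ two_ne_zero hη)).symm
  · rintro rfl
    rfl

lemma areOppositeOn (hA : IsAdmissible a U h H) :
    AreOppositeOn (domain a U) (metric a h H) (ΩBar a h H) (Ω a h H) := by
  intro p hp
  have hE := hA.coframe_frame hp
  -- In the order E₁, E₂, E₄, E₃ the forms become Ω̄ = e¹² + e³⁴ and Ω = e¹² - e³⁴.
  refine ⟨![frame a h H 0 p, frame a h H 1 p, frame a h H 3 p, frame a h H 2 p], ?_, ?_, ?_⟩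
  · intro i j
    rw [metric_eq]
    fin_cases i <;> fin_cases j <;> simp [hE]
  · simp [IsDualInFrame, ΩBar_apply, hE, jBar]
  · simp [IsDualInFrame, Ω_apply, hE, jOpp]

lemma isHermitianOn_jBar (hA : IsAdmissible a U h H) :
    IsHermitianOn (domain a U) (metric a h H) (frameEndo (coframe a h H) (frame a h H) jBar) := by
  refine hA.isMovingFrameOn.isHermitianOn_frameEndo hA.smooth_metric jBar_sq ?_ ?_
  · rw [jBar_transpose, Matrix.neg_mul, jBar_sq, neg_neg]
  · intro p _ X Y i
    simp [connComm_jBar]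

lemma isHermitianOn_jOpp (hA : IsAdmissible a U h H) :
    IsHermitianOn (domain a U) (metric a h H) (frameEndo (coframe a h H) (frame a h H) jOpp) := by
  refine hA.isMovingFrameOn.isHermitianOn_frameEndo hA.smooth_metric jOpp_sq ?_ ?_
  · rw [jOpp_transpose, Matrix.neg_mul, jOpp_sq, neg_neg]
  · intro p hp X Y i
    have hJ := hA.isMovingFrameOn.coframe_frameEndo (j := jOpp) hp
    have h1 : ∀ X, θ₁ a h p (frameEndo (coframe a h H) (frame a h H) jOpp p X) = -θ₂ a h p X := by
      intro X
      refine (hJ 0 X).trans ?_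
      simp [Fin.sum_univ_four, jOpp, coframe]
    have h2 : ∀ X, θ₂ a h p (frameEndo (coframe a h H) (frame a h H) jOpp p X) = θ₁ a h p X := by
      intro X
      refine (hJ 1 X).trans ?_
      simp [Fin.sum_univ_four, jOpp, coframe]
    -- Replacing V by JV in the commutator C(V) amounts to multiplying by J on the left, C(JV) = J
    -- C(V), so the terms of the condition cancel in pairs.
    simp only [connComm_jOpp, h1, h2, Fin.sum_univ_four]
    fin_cases i <;> simp [jOpp, coframe] <;> ring

lemma isKaehlerFormOn_ΩBar (hA : IsAdmissible a U h H) :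
    IsKaehlerFormOn (domain a U) (metric a h H)
      (frameEndo (coframe a h H) (frame a h H) jBar) (ΩBar a h H) :=
  hA.isMovingFrameOn.isKaehlerFormOn_frameEndo fun p _ => ΩBar_apply p

lemma isKaehlerFormOn_Ω (hA : IsAdmissible a U h H) :
    IsKaehlerFormOn (domain a U) (metric a h H)
      (frameEndo (coframe a h H) (frame a h H) jOpp) (Ω a h H) :=
  hA.isMovingFrameOn.isKaehlerFormOn_frameEndo fun p _ => Ω_apply p

/-! ### Ricci tensor, holomorphic sectional curvature and the QCH property. -/

/-- In the frame, the Ricci tensor is diagonal with eigenvalues `K + 2a²` (twice), `6a²` (twice). -/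
lemma ricci_eq (hA : IsAdmissible a U h H) (hp : p ∈ domain a U) (Y Z : E4) :
    ricci (metric a h H) p Y Z
      = (horizontalCurv a h H p + 2 * a ^ 2)
          * (θ₁ a h p Y * θ₁ a h p Z + θ₂ a h p Y * θ₂ a h p Z)
        + 6 * a ^ 2 * (θ₃ a H p Y * θ₃ a H p Z + θ₄ a H p Y * θ₄ a H p Z) := by
  have hE := hA.coframe_frame hp
  have h1 : ∀ i, θ₁ a h p (frame a h H i p) = if 0 = i then 1 else 0 := hE 0
  have h2 : ∀ i, θ₂ a h p (frame a h H i p) = if 1 = i then 1 else 0 := hE 1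
  have h3 : ∀ i, θ₃ a H p (frame a h H i p) = if 2 = i then 1 else 0 := hE 2
  have h4 : ∀ i, θ₄ a H p (frame a h H i p) = if 3 = i then 1 else 0 := hE 3
  rw [hA.isMovingFrameOn.ricci_eq hp]
  simp only [hA.curvForm_eq hp, wd, h1, h2, h3, h4, Fin.sum_univ_four]
  simp [coframe]
  ring

lemma hasInvariantRicciOn (hA : IsAdmissible a U h H) :
    HasInvariantRicciOn (domain a U) (metric a h H)
      (frameEndo (coframe a h H) (frame a h H) jOpp) := by
  intro p hp X Y
  have hJ : ∀ i X, coframe a h H i p (frameEndo (coframe a h H) (frame a h H) jOpp p X)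
      = ![-θ₂ a h p X, θ₁ a h p X, -θ₄ a H p X, θ₃ a H p X] i := by
    intro i X
    rw [hA.isMovingFrameOn.coframe_frameEndo hp]
    fin_cases i <;> simp [Fin.sum_univ_four, jOpp, coframe]
  have h1 : ∀ X, θ₁ a h p (frameEndo (coframe a h H) (frame a h H) jOpp p X) = -θ₂ a h p X := hJ 0
  have h2 : ∀ X, θ₂ a h p (frameEndo (coframe a h H) (frame a h H) jOpp p X) = θ₁ a h p X := hJ 1
  have h3 : ∀ X, θ₃ a H p (frameEndo (coframe a h H) (frame a h H) jOpp p X) = -θ₄ a H p X := hJ 2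
  have h4 : ∀ X, θ₄ a H p (frameEndo (coframe a h H) (frame a h H) jOpp p X) = θ₃ a H p X := hJ 3
  simp only [hA.ricci_eq hp, h1, h2, h3, h4]
  ring

lemma holCurv_eq (hA : IsAdmissible a U h H) (hp : p ∈ domain a U) (X : E4) :
    holCurv (metric a h H) (frameEndo (coframe a h H) (frame a h H) jBar) p X
      = horizontalCurv a h H p * (θ₁ a h p X ^ 2 + θ₂ a h p X ^ 2) ^ 2
        + 8 * a ^ 2 * (θ₁ a h p X ^ 2 + θ₂ a h p X ^ 2) * (θ₃ a H p X ^ 2 + θ₄ a H p X ^ 2)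
        + 4 * a ^ 2 * (θ₃ a H p X ^ 2 + θ₄ a H p X ^ 2) ^ 2 := by
  have hJ : ∀ i X, coframe a h H i p (frameEndo (coframe a h H) (frame a h H) jBar p X)
      = ![-θ₂ a h p X, θ₁ a h p X, θ₄ a H p X, -θ₃ a H p X] i := by
    intro i X
    rw [hA.isMovingFrameOn.coframe_frameEndo hp]
    fin_cases i <;> simp [Fin.sum_univ_four, jBar, coframe]
  have h1 : ∀ X, θ₁ a h p (frameEndo (coframe a h H) (frame a h H) jBar p X) = -θ₂ a h p X := hJ 0
  have h2 : ∀ X, θ₂ a h p (frameEndo (coframe a h H) (frame a h H) jBar p X) = θ₁ a h p X := hJ 1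
  have h3 : ∀ X, θ₃ a H p (frameEndo (coframe a h H) (frame a h H) jBar p X) = θ₄ a H p X := hJ 2
  have h4 : ∀ X, θ₄ a H p (frameEndo (coframe a h H) (frame a h H) jBar p X) = -θ₃ a H p X := hJ 3
  rw [holCurv, hA.isMovingFrameOn.metric_riemann hp]
  simp only [hA.curvForm_eq hp, wd, hJ, h1, h2, h3, h4, Fin.sum_univ_four]
  simp [coframe]
  ring

lemma mem_vertical_iff (p X : E4) : X ∈ vertical p ↔ X 0 = 0 ∧ X 1 = 0 := by
  rw [vertical, Submodule.mem_span_pair]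
  constructor
  · rintro ⟨s, t, rfl⟩
    simp [e]
  · rintro ⟨h0, h1⟩
    refine ⟨X 2, X 3, ?_⟩
    ext i
    fin_cases i <;> simp [e, h0, h1]

lemma finrank_vertical (p : E4) : Module.finrank ℝ (vertical p) = 2 := by
  have hli : LinearIndependent ℝ ![e 2, e 3] := by
    rw [LinearIndependent.pair_iff]
    intro s t hst
    have h2 := congrFun hst 2
    have h3 := congrFun hst 3
    simp [e] at h2 h3
    exact ⟨h2, h3⟩
  have := finrank_span_eq_card hli
  rwa [Matrix.range_cons_cons_empty, Fintype.card_fin] at this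

lemma isQCHKaehlerOn (hA : IsAdmissible a U h H) :
    IsQCHKaehlerOn (domain a U) (metric a h H)
      (frameEndo (coframe a h H) (frame a h H) jBar) vertical where
  kaehler := ⟨hA.isHermitianOn_jBar, ΩBar a h H, hA.isKaehlerFormOn_ΩBar,
    fun _ hp => hA.extDeriv_ΩBar hp⟩
  smooth p hp := ⟨finrank_vertical p, domain a U, hA.isOpen_domain, hp, subset_rfl,
    fun _ => e 2, fun _ => e 3, contDiffOn_const, contDiffOn_const, fun _ _ => rfl⟩
  invariant p hp X hX := by
    have hc := mul_ne_zero (hA.cos_ne_zero hp) (hA.h_pos _ hp.1).ne'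
    rw [mem_vertical_iff] at hX ⊢
    have h0 := hA.isMovingFrameOn.coframe_frameEndo (j := jBar) hp 0 X
    have h1 := hA.isMovingFrameOn.coframe_frameEndo (j := jBar) hp 1 X
    simp [Fin.sum_univ_four, jBar, coframe, θ₁, θ₂, hX] at h0 h1
    have hc' := mul_ne_zero_iff.mp hc
    exact ⟨by tauto, by tauto⟩
  curvature := by
    -- For a unit vector the squared horizontal length is 1 - d², so `holCurv_eq` becomes a function
    -- of p and d.
    refine ⟨fun p d => horizontalCurv a h H p * (1 - d ^ 2) ^ 2
      + 8 * a ^ 2 * (1 - d ^ 2) * d ^ 2 + 4 * a ^ 2 * (d ^ 2) ^ 2, fun p hp X P hX hP => ?_⟩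
    obtain ⟨hPv, hPo⟩ := hP
    have hE := hA.coframe_frame hp
    -- E₃ and E₄ are vertical, so X - P is orthogonal to them and P has the same θ₃ and θ₄
    -- components as X.
    have hproj : ∀ i, frame a h H i p ∈ vertical p →
        coframe a h H i p P = coframe a h H i p X := by
      intro i hi
      have := hPo _ hi
      rw [metric_eq] at this
      simp only [hE, mul_ite, mul_one, mul_zero, Finset.sum_ite_eq', Finset.mem_univ, if_true,
        map_sub] at this
      linarith
    have h3 : θ₃ a H p P = θ₃ a H p X :=
      hproj 2 ((mem_vertical_iff p _).mpr (by simp [frame, e]))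
    have h4 : θ₄ a H p P = θ₄ a H p X :=
      hproj 3 ((mem_vertical_iff p _).mpr (by simp [frame, e]))
    rw [mem_vertical_iff] at hPv
    have hd : metric a h H p P P = θ₃ a H p X ^ 2 + θ₄ a H p X ^ 2 := by
      rw [metric_eq]
      simp [Fin.sum_univ_four, coframe, θ₁, θ₂, hPv, h3, h4]
      ring
    have hX' : θ₁ a h p X ^ 2 + θ₂ a h p X ^ 2 = 1 - (θ₃ a H p X ^ 2 + θ₄ a H p X ^ 2) := by
      rw [metric_eq] at hX
      simp only [Fin.sum_univ_four, coframe, Matrix.cons_val] at hX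
      linarith
    simp only [hd]
    rw [hA.holCurv_eq hp, hX', Real.sq_sqrt (by positivity)]

/-! ### Failure of the locally conformally Kähler condition. -/

lemma domain_nonempty (hA : IsAdmissible a U h H) (hne : U.Nonempty) : (domain a U).Nonempty := by
  obtain ⟨q, hq⟩ := hne
  have ha := abs_pos.mpr hA.ne_zero
  have hz : 0 < Real.pi / (4 * |a|) := by positivity
  refine ⟨![q.1, q.2, Real.pi / (4 * |a|), 0], hq, ?_, ?_⟩
  · simpa using hA.ne_zero
  · change |Real.pi / (4 * |a|)| < _
    rw [abs_of_pos hz]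
    have := Real.pi_pos
    gcongr
    norm_num

lemma not_isLocallyConformallyKaehlerOn (hA : IsAdmissible a U h H) (hne : U.Nonempty) :
    ¬ IsLocallyConformallyKaehlerOn (domain a U) (metric a h H)
      (frameEndo (coframe a h H) (frame a h H) jOpp) := by
  intro hL
  obtain ⟨p, hp⟩ := hA.domain_nonempty hne
  obtain ⟨W, hW, hpW, hWM, f, hf, hfpos, -, Ω', hform, hclosed⟩ := hL p hp
  -- From 0 = d(fΩ) = (df + 2fθ) ∧ Ω with θ = -2a tan(az) θ₄; injectivity of the wedge with Ω gives
  -- df = -2fθ, whence the factor 4.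
  have hdf : ∀ q ∈ W, fderiv ℝ f q
      = (f q * (4 * (a * Real.tan (a * q 2)))) • θ₄ a H q := by
    intro q hq
    have hqM := hWM hq
    have h1 : Ω' =ᶠ[nhds q] fun q => f q • Ω a h H q := by
      filter_upwards [hW.mem_nhds hq] with r hr
      refine form_ext_two fun X Y => ?_
      rw [hform r hr, ContinuousAlternatingMap.smul_apply, hA.isKaehlerFormOn_Ω r (hWM hr)]
      rfl
    have h2 := hclosed q hq
    rw [h1.extDeriv_eq, extDeriv_smul_form (differentiableAt_of_contDiffOn hW hf hq)
      (hA.differentiableAt_Ω hqM), hA.extDeriv_Ω hqM] at h2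
    refine hA.wedge_Ω_injective hqM (form_ext_three fun X Y Z => ?_)
    have h3 := congrArg (fun w : E4 [⋀^Fin 3]→L[ℝ] ℝ => w ![X, Y, Z]) h2
    simp only [ContinuousAlternatingMap.add_apply, ContinuousAlternatingMap.smul_apply,
      wedge_apply_three, _root_.smul_apply,
      smul_eq_mul] at h3 ⊢
    have h0 : (0 : E4 [⋀^Fin 3]→L[ℝ] ℝ) ![X, Y, Z] = 0 := rfl
    linear_combination h3 + h0
  have hsymm : ∀ X Y, ext₁ (fun q => (f q * (4 * (a * Real.tan (a * q 2)))) • θ₄ a H q) p X Y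
      = 0 := by
    intro X Y
    have h1 : fderiv ℝ f =ᶠ[nhds p]
        fun q => (f q * (4 * (a * Real.tan (a * q 2)))) • θ₄ a H q := by
      filter_upwards [hW.mem_nhds hpW] with q hq using hdf q hq
    rw [ext₁, ← h1.fderiv_eq, sub_eq_zero]
    exact (((hf.contDiffAt (hW.mem_nhds hpW)).isSymmSndFDerivAt
      (by rw [minSmoothness_of_isRCLikeNormedField]
          exact WithTop.coe_le_coe.mpr (le_top (a := 2)))).eq X Y)
  have hfd : DifferentiableAt ℝ (fun q : E4 => f q * (4 * (a * Real.tan (a * q 2)))) p :=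
    (differentiableAt_of_contDiffOn hW hf hpW).fun_mul ((hA.differentiableAt_tan hp).const_mul 4)
  have hnz : f p * (4 * (a * Real.tan (a * p 2))) ≠ 0 :=
    mul_ne_zero (hfpos p hpW).ne' (mul_ne_zero four_ne_zero
      (mul_ne_zero hA.ne_zero (tan_ne_zero_of_mem_domain hA.ne_zero hp)))
  -- Testing the closed form u θ₄, u ≠ 0, on ∂_t and Y, both in ker θ₄, leaves u dθ₄(∂_t, Y) = -2au
  -- φ(Y), because γ(∂_t) = 1 and φ(∂_t) = 0.
  have hclosed₄ : ∀ Y, θ₄ a H p Y = 0 → φForm a H p Y = 0 := by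
    intro Y hY
    have h1 := hsymm (e 3) Y
    have h3 : θ₄ a H p (e 3) = 0 := by simp [θ₄, e]
    have hγ : γForm a H p (e 3) = 1 := by simp [γForm, e]
    have hφ : φForm a H p (e 3) = 0 := by simp [φForm, e]
    have hψ := hA.differentiableAt_of_smooth hp hA.smooth_ψ
    rw [ext₁_smul hfd (hA.differentiableAt_of_smooth hp hA.smooth_θ₄), hY, h3, θ₄_eq,
      ext₁_sub (differentiableAt_const _) hψ, ext₁_const, hA.ext₁_ψ hp, wd, hγ, hφ] at h1
    simpa [hA.ne_zero, hnz, (hfpos p hpW).ne', tan_ne_zero_of_mem_domain hA.ne_zero hp] using h1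
  have hH := (hA.H_pos _ hp.1).ne'
  -- These lifts of ∂_x and ∂_y lie in ker θ₄, and φ takes the values H cos 2at and -H sin 2at on
  -- them; both cannot vanish.
  have hc := hclosed₄ (e 0 + (Real.sin (2 * a * p 3) * H (xy p)) • e 2) (by simp [θ₄, e])
  have hs := hclosed₄ (e 1 + (Real.cos (2 * a * p 3) * H (xy p)) • e 2) (by simp [θ₄, e])
  simp [φForm, e, hH] at hc hs
  have := Real.sin_sq_add_cos_sq (2 * a * p 3)
  rw [hc, hs] at this
  norm_num at this

end IsAdmissible

end KaehlerSurface

theorem theorem2 (a : ℝ) (ha : a ≠ 0) (U : Set (ℝ × ℝ)) (hU : IsOpen U) (hne : U.Nonempty)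
    (h H : ℝ × ℝ → ℝ) (hh : ContDiffOn ℝ ∞ h U) (hH : ContDiffOn ℝ ∞ H U)
    (hpos : ∀ q ∈ U, 0 < h q) (Hpos : ∀ q ∈ U, 0 < H q)
    (hΔ : ∀ q ∈ U, pdx (pdx (lnf H)) q + pdy (pdy (lnf H)) q
      = 2 * a ^ 2 * h q ^ 2 - 4 * a ^ 2 * H q ^ 2) :
    IsRiemannianMetricOn (domain a U) (metric a h H) ∧
    ∃ JBar J : E4 → E4 →L[ℝ] E4,
      IsQCHKaehlerOn (domain a U) (metric a h H) JBar vertical ∧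
      IsKaehlerFormOn (domain a U) (metric a h H) JBar (ΩBar a h H) ∧
      IsHermitianOn (domain a U) (metric a h H) J ∧
      IsKaehlerFormOn (domain a U) (metric a h H) J (Ω a h H) ∧
      AreOppositeOn (domain a U) (metric a h H) (ΩBar a h H) (Ω a h H) ∧
      HasInvariantRicciOn (domain a U) (metric a h H) J ∧
      ¬ IsLocallyConformallyKaehlerOn (domain a U) (metric a h H) J ∧
      IsLeeFormOn (domain a U) (Ω a h H)
        (fun p => -(2 * a * Real.tan (a * p 2)) • θ₄ a H p) := by
  have hA : IsAdmissible a U h H := ⟨ha, hU, hh, hH, hpos, Hpos, hΔ⟩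
  exact ⟨hA.isHermitianOn_jOpp.metric, frameEndo (coframe a h H) (frame a h H) jBar,
    frameEndo (coframe a h H) (frame a h H) jOpp, hA.isQCHKaehlerOn, hA.isKaehlerFormOn_ΩBar,
    hA.isHermitianOn_jOpp, hA.isKaehlerFormOn_Ω, hA.areOppositeOn, hA.hasInvariantRicciOn,
    hA.not_isLocallyConformallyKaehlerOn hne, hA.isLeeFormOn⟩
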